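/- Let $N\ge 1$ and $Q=(0,1)^N$; all functions are complex valued. Let $H^1(T^N)$ be the Sobolev space of the torus $T^N=\mathbb R^N/\mathbb Z^N$, its elements being identified with functions on $Q$, and let $H^{-1}(T^N)$ be the space of continuous antilinear functionals on $H^1(T^N)$. Put $$\mathrm{Har}(Q)=\Big\{u\in H^1(Q):\int_Q\nabla u\cdot\overline{\nabla v}\,dx=0\ \ \forall v\in H^1_0(Q)\Big\},$$ $$\mathrm{Har}(T^N)=\Big\{u\in H^1(T^N):\int_Q\nabla u\cdot\overline{\nabla v}\,dx=0\ \ \forall v\in H^1_0(Q)\Big\},$$ $$H=\{w\in H^{-1}(T^N):\langle w,v\rangle=0\ \ \forall v\in \mathrm{Har}(T^N)\},$$ $$V=\Big\{f\in L^2(Q):\int_Q f\,\overline h\,dx=0\ \ \forall h\in\mathrm{Har}(Q)\Big\}.$$ The space $L^2(Q)$ is embedded in $H^{-1}(T^N)$ by $\langle f,v\rangle=\int_Q f\,\overline v\,dx$; in particular $V\subset H$. For $g\in H$ let $u_g\in H^1(T^N)$ be the function with mean zero such that $\int_Q\nabla u_g\cdot\overline{\nabla v}\,dx=-\langle g,v\rangle$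 for all $v\in H^1(T^N)$. Let $A$ be the operator in $H$ given by $$D(A)=\Big\{f\in V:\ \exists g\in H\ \ \int_Q f\,\overline h\,dx=\int_Q\nabla u_g\cdot\overline{\nabla u_h}\,dx\ \ \forall h\in V\Big\},\qquad Af=g.$$ **Theorem.** There is exactly one strongly continuous semigroup $(e^{-tA})_{t\ge0}$ of bounded operators on $H$ whose generator is $-A$. Let $u_0\in D(A)$ and $u(t)=e^{-tA}u_0$ for $t\ge 0$. Then $u(t)\in L^2(Q)$ for all $t\ge0$, $u(0)=u_0$, and $u$ solves the heat equation $\partial_tu=\Delta u$ in the sense of distributions: for every $t>0$, 1. $\int_Q u(t,y)\,\overline{h(y)}\,dy=0$ for all $h\in\mathrm{Har}(Q)$; 2. $u$ is differentiable at $t$ as a function with values in $H$, the distributional Laplacian $\Delta u(t)$ on $Q$ extends to a continuous antilinear functional on $H^1_0(Q)$, and $\langle \partial_tu(t)-\Delta u(t),g\rangle=0$ for all $g\in H^1_0(Q)$; 3. in particular, the moments of order $0$ and $1$ vanish: $\int_Q u(t,y)\,dy=0$ and $\int_Q y_i\,u(t,y)\,dy=0$ for $i=1,\dots,N$. -/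

import Mathlib

open MeasureTheory Filter Topology
open scoped ContDiff NNReal ComplexConjugate

noncomputable section

namespace HeatCube

/-! ### Functions on the cube -/

/-- The open unit cube `(0,1)^N`. -/
def cube (N : ℕ) : Set (Fin N → ℝ) := Set.univ.pi fun _ => Set.Ioo (0 : ℝ) 1

/-- Lebesgue measure on the cube. -/
abbrev cubeMeasure (N : ℕ) : Measure (Fin N → ℝ) := volume.restrict (cube N)

/-- The complex Hilbert space `L²((0,1)^N)`. The inner product of Mathlib is antilinear in its
first argument, so `inner ℂ h f` is the integral of `f` times the conjugate of `h`. -/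
abbrev L2 (N : ℕ) := Lp ℂ 2 (cubeMeasure N)

/-- The Hilbert space of pairs `(u, G)` of a function `u = x.fst` and a vector field
`G = x.snd`, both square integrable on the cube. All the spaces of type `H¹` below are spaces of
pairs `(u, ∇u)` with the norm `(‖u‖² + ‖∇u‖²)^{1/2}`. -/
abbrev Pairs (N : ℕ) := WithLp 2 (L2 N × PiLp 2 fun _ : Fin N => L2 N)

/-- The classical partial derivative in the direction of the `i`-th axis. -/
def partialDeriv {N : ℕ} (i : Fin N) (φ : (Fin N → ℝ) → ℂ) : (Fin N → ℝ) → ℂ :=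
  fun x => fderiv ℝ φ x (Pi.single i 1)

/-- The classical Laplacian. -/
def classicalLaplacian {N : ℕ} (φ : (Fin N → ℝ) → ℂ) : (Fin N → ℝ) → ℂ :=
  fun x => ∑ i, partialDeriv i (partialDeriv i φ) x

/-- Test functions on the cube: smooth functions with compact support in the open cube. -/
def IsTestFunction {N : ℕ} (φ : (Fin N → ℝ) → ℂ) : Prop :=
  ContDiff ℝ ∞ φ ∧ HasCompactSupport φ ∧ tsupport φ ⊆ cube N

/-- Smooth functions on the torus `T^N`: smooth functions on `ℝ^N` of period one in every
coordinate. -/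
def IsSmoothPeriodic {N : ℕ} (φ : (Fin N → ℝ) → ℂ) : Prop :=
  ContDiff ℝ ∞ φ ∧ ∀ (i : Fin N) (x : Fin N → ℝ), φ (x + Pi.single i 1) = φ x

theorem measurableSet_cube (N : ℕ) : MeasurableSet (cube N) :=
  MeasurableSet.univ_pi fun _ => measurableSet_Ioo

theorem isOpen_cube (N : ℕ) : IsOpen (cube N) :=
  isOpen_set_pi Set.finite_univ fun _ _ => isOpen_Ioo

theorem cube_subset_Icc (N : ℕ) : cube N ⊆ Set.Icc 0 1 := fun _ hx =>
  ⟨fun i => (hx i trivial).1.le, fun i => (hx i trivial).2.le⟩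

instance (N : ℕ) : IsFiniteMeasure (cubeMeasure N) :=
  ⟨by
    rw [Measure.restrict_apply_univ]
    exact (measure_mono (cube_subset_Icc N)).trans_lt isCompact_Icc.measure_lt_top⟩

theorem memLp_of_continuous {N : ℕ} {φ : (Fin N → ℝ) → ℂ} (hφ : Continuous φ) :
    MemLp φ 2 (cubeMeasure N) := by
  obtain ⟨C, hC⟩ := (isCompact_Icc (a := (0 : Fin N → ℝ)) (b := 1)).exists_bound_of_continuousOn
    hφ.continuousOn
  refine MemLp.of_bound hφ.aestronglyMeasurable C ?_
  filter_upwards [ae_restrict_mem (measurableSet_cube N)] with x hx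
  exact hC x (cube_subset_Icc N hx)

theorem contDiff_partialDeriv {N : ℕ} {φ : (Fin N → ℝ) → ℂ} (hφ : ContDiff ℝ ∞ φ) (i : Fin N) :
    ContDiff ℝ ∞ (partialDeriv i φ) :=
  (hφ.fderiv_right (m := ∞) (by simp)).clm_apply contDiff_const

/-- The pair `(φ, ∇φ)` on the cube, for a smooth function `φ` on `ℝ^N`. -/
def smoothPair {N : ℕ} (φ : (Fin N → ℝ) → ℂ) (hφ : ContDiff ℝ ∞ φ) : Pairs N :=
  WithLp.toLp 2 ((memLp_of_continuous hφ.continuous).toLp φ,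
    WithLp.toLp 2 fun i =>
      (memLp_of_continuous (contDiff_partialDeriv hφ i).continuous).toLp (partialDeriv i φ))

/-! ### Sobolev spaces -/

/-- `u.snd` is the weak gradient of `u.fst` with respect to the test function `φ`: for all `i`,
`∫ u (∂ᵢφ)‾ = - ∫ (∂ᵢu) φ‾`, the integrals being taken over the cube. -/
def WeakGradientAgainst {N : ℕ} (φ : (Fin N → ℝ) → ℂ) (hφ : ContDiff ℝ ∞ φ) (u : Pairs N) : Prop :=
  ∀ i, inner ℂ ((smoothPair φ hφ).snd i) u.fst = -inner ℂ (smoothPair φ hφ).fst (u.snd i)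

/-- The pairs satisfying the weak gradient relation for all smooth test functions of a class. -/
def weakGradientSpace {N : ℕ} (T : ((Fin N → ℝ) → ℂ) → Prop) : Submodule ℂ (Pairs N) where
  carrier := {u | ∀ (φ : (Fin N → ℝ) → ℂ) (hφ : ContDiff ℝ ∞ φ), T φ → WeakGradientAgainst φ hφ u}
  zero_mem' := fun φ hφ _ i => by simp
  add_mem' := fun {u v} hu hv φ hφ hT i => by
    have h1 := hu φ hφ hT i
    have h2 := hv φ hφ hT i
    simp only [WithLp.add_fst, WithLp.add_snd, PiLp.add_apply, inner_add_right]
    rw [h1, h2]; ring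
  smul_mem' := fun c {u} hu φ hφ hT i => by
    have h1 := hu φ hφ hT i
    simp only [WithLp.smul_fst, WithLp.smul_snd, PiLp.smul_apply, inner_smul_right]
    rw [h1]; ring

/-- `H¹((0,1)^N)`: weak derivatives in the cube are tested against `C_c^∞((0,1)^N)`. -/
def H1 (N : ℕ) : Submodule ℂ (Pairs N) := weakGradientSpace IsTestFunction

/-- `H¹(T^N)`: weak derivatives on the torus are tested against `C^∞(T^N)`; functions on the torus
are identified with functions on the cube. -/
def H1per (N : ℕ) : Submodule ℂ (Pairs N) := weakGradientSpace IsSmoothPeriodic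

/-- `H¹₀((0,1)^N)`: the closure of `C_c^∞((0,1)^N)` in the `H¹`-norm. -/
def H10 (N : ℕ) : Submodule ℂ (Pairs N) :=
  (Submodule.span ℂ {u | ∃ (φ : (Fin N → ℝ) → ℂ) (hφ : IsTestFunction φ),
    u = smoothPair φ hφ.1}).topologicalClosure

/-- The elements `u` of a space of pairs with `∫ ∇u (∇v)‾ = 0` for all `v ∈ H¹₀((0,1)^N)`. -/
def harmonicPart {N : ℕ} (X : Submodule ℂ (Pairs N)) : Submodule ℂ (Pairs N) where
  carrier := {u | u ∈ X ∧ ∀ v ∈ H10 N, inner ℂ v.snd u.snd = 0}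
  zero_mem' := ⟨X.zero_mem, fun v _ => by simp⟩
  add_mem' := fun {u w} hu hw => ⟨X.add_mem hu.1 hw.1, fun v hv => by
    rw [WithLp.add_snd, inner_add_right, hu.2 v hv, hw.2 v hv, add_zero]⟩
  smul_mem' := fun c {u} hu => ⟨X.smul_mem c hu.1, fun v hv => by
    rw [WithLp.smul_snd, inner_smul_right, hu.2 v hv, mul_zero]⟩

/-- `Har((0,1)^N)`, the weakly harmonic functions of class `H¹` on the cube. -/
def Har (N : ℕ) : Submodule ℂ (Pairs N) := harmonicPart (H1 N)

/-- `Har(T^N)`, the weakly harmonic functions in `H¹(T^N)`. -/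
def HarPer (N : ℕ) : Submodule ℂ (Pairs N) := harmonicPart (H1per N)

/-! ### Inclusions between these spaces -/

theorem smoothPair_congr {N : ℕ} {φ ψ : (Fin N → ℝ) → ℂ} (hφ : ContDiff ℝ ∞ φ)
    (hψ : ContDiff ℝ ∞ ψ) (h : Set.EqOn φ ψ (cube N)) : smoothPair φ hφ = smoothPair ψ hψ := by
  have h0 : (memLp_of_continuous hφ.continuous).toLp φ =
      (memLp_of_continuous hψ.continuous).toLp ψ := by
    rw [MemLp.toLp_eq_toLp_iff]
    filter_upwards [ae_restrict_mem (measurableSet_cube N)] with x hx using h hx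
  have h1 : ∀ i, (memLp_of_continuous (contDiff_partialDeriv hφ i).continuous).toLp
      (partialDeriv i φ) = (memLp_of_continuous (contDiff_partialDeriv hψ i).continuous).toLp
      (partialDeriv i ψ) := by
    intro i
    rw [MemLp.toLp_eq_toLp_iff]
    filter_upwards [ae_restrict_mem (measurableSet_cube N)] with x hx
    have : φ =ᶠ[𝓝 x] ψ := by
      filter_upwards [(isOpen_cube N).mem_nhds hx] with y hy using h hy
    simp only [partialDeriv, this.fderiv_eq]
  simp only [smoothPair, h0, h1]

/-- A test function on the cube extends to a smooth periodic function. -/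
theorem exists_periodic_extension {N : ℕ} {φ : (Fin N → ℝ) → ℂ} (hφ : IsTestFunction φ) :
    ∃ ψ, IsSmoothPeriodic ψ ∧ Set.EqOn φ ψ (cube N) := by
  refine ⟨fun x => φ fun i => Int.fract (x i), ⟨?_, ?_⟩, ?_⟩
  · rw [contDiff_iff_contDiffAt]
    intro x
    by_cases hx : ∀ i, Int.fract (x i) ≠ 0
    · have hev : (fun y : Fin N → ℝ => φ fun i => Int.fract (y i)) =ᶠ[𝓝 x]
          fun y => φ (y - fun i => (⌊x i⌋ : ℝ)) := by
        have : ∀ᶠ y in 𝓝 x, ∀ i, ⌊y i⌋ = ⌊x i⌋ := by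
          rw [Filter.eventually_all]
          intro i
          have hi : x i ∈ Set.Ioo ((⌊x i⌋ : ℝ)) (⌊x i⌋ + 1) :=
            ⟨lt_of_le_of_ne (Int.floor_le _) fun h => hx i (by
              rw [Int.fract]; linarith), Int.lt_floor_add_one _⟩
          filter_upwards [(continuous_apply i).continuousAt.preimage_mem_nhds
            (isOpen_Ioo.mem_nhds hi)] with y hy
          exact Int.floor_eq_iff.2 ⟨hy.1.le, hy.2⟩
        filter_upwards [this] with y hy
        congr 1
        funext i
        simp [Int.fract, hy i]
      exact ((hφ.1.comp (contDiff_id.sub contDiff_const)).contDiffAt).congr_of_eventuallyEq hev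
    · push Not at hx
      obtain ⟨i, hi⟩ := hx
      -- the support stays away from the faces of the cube
      have hK : IsCompact ((fun y : Fin N → ℝ => y i) '' tsupport φ) :=
        hφ.2.1.isCompact.image (continuous_apply i)
      have h0 : (fun y : Fin N → ℝ => y i) '' tsupport φ ⊆ Set.Ioo 0 1 := by
        rintro _ ⟨y, hy, rfl⟩
        exact hφ.2.2 hy i trivial
      have hU : ∀ᶠ s in 𝓝 (0 : ℝ), s ∉ (fun y : Fin N → ℝ => y i) '' tsupport φ :=
        hK.isClosed.isOpen_compl.mem_nhds fun h => lt_irrefl _ (h0 h).1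
      have hU' : ∀ᶠ s in 𝓝 (1 : ℝ), s ∉ (fun y : Fin N → ℝ => y i) '' tsupport φ :=
        hK.isClosed.isOpen_compl.mem_nhds fun h => lt_irrefl _ (h0 h).2
      have hxi : x i = (⌊x i⌋ : ℝ) := by
        have := Int.fract_add_floor (x i); rw [hi] at this; linarith
      have hc : Tendsto (fun y : Fin N → ℝ => y i - (⌊x i⌋ : ℝ)) (𝓝 x) (𝓝 0) := by
        have : Tendsto (fun y : Fin N → ℝ => y i - (⌊x i⌋ : ℝ)) (𝓝 x)
            (𝓝 (x i - (⌊x i⌋ : ℝ))) := ((continuous_apply i).sub continuous_const).tendsto x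
        rwa [sub_eq_zero.2 hxi] at this
      have hc' : Tendsto (fun y : Fin N → ℝ => y i - (⌊x i⌋ : ℝ) + 1) (𝓝 x) (𝓝 1) := by
        simpa using hc.add_const 1
      have hev : (fun y : Fin N → ℝ => φ fun i => Int.fract (y i)) =ᶠ[𝓝 x] fun _ => 0 := by
        filter_upwards [hc.eventually hU, hc'.eventually hU',
          hc.eventually (Ioo_mem_nhds (by norm_num : (-1 : ℝ) < 0) one_pos)] with y h1 h2 h3
        apply image_eq_zero_of_notMem_tsupport
        intro hmem
        have hfr : Int.fract (y i) = y i - ⌊x i⌋ ∨ Int.fract (y i) = y i - ⌊x i⌋ + 1 := by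
          rcases le_or_gt 0 (y i - ⌊x i⌋) with h | h
          · left
            have : ⌊y i⌋ = ⌊x i⌋ := Int.floor_eq_iff.2 ⟨by linarith, by linarith [h3.2]⟩
            rw [Int.fract, this]
          · right
            have : ⌊y i⌋ = ⌊x i⌋ - 1 := Int.floor_eq_iff.2
              ⟨by push_cast; linarith [h3.1], by push_cast; linarith⟩
            rw [Int.fract, this]; push_cast; ring
        rcases hfr with h | h
        · exact h1 (h ▸ Set.mem_image_of_mem _ hmem)
        · exact h2 (h ▸ Set.mem_image_of_mem _ hmem)
      exact contDiffAt_const.congr_of_eventuallyEq hev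
  · intro i x
    refine congrArg φ (funext fun j => ?_)
    by_cases h : j = i
    · subst h; simp only [Pi.add_apply, Pi.single_eq_same, Int.fract_add_one]
    · simp [Pi.single_eq_of_ne h]
  · intro x hx
    simp only
    congr 1
    funext i
    exact (Int.fract_eq_self.2 ⟨(hx i trivial).1.le, (hx i trivial).2⟩).symm

theorem H1per_le_H1 (N : ℕ) : H1per N ≤ H1 N := by
  intro u hu φ hφ hT i
  obtain ⟨ψ, hψ, hEq⟩ := exists_periodic_extension hT
  have := hu ψ hψ.1 hψ i
  rwa [← smoothPair_congr hφ hψ.1 hEq] at this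

theorem HarPer_le_Har (N : ℕ) : HarPer N ≤ Har N := fun _ hu => ⟨H1per_le_H1 N hu.1, hu.2⟩

theorem isClosed_weakGradientSpace {N : ℕ} (T : ((Fin N → ℝ) → ℂ) → Prop) :
    IsClosed (weakGradientSpace T : Set (Pairs N)) := by
  have : (weakGradientSpace T : Set (Pairs N)) = ⋂ (φ : (Fin N → ℝ) → ℂ),
      ⋂ (hφ : ContDiff ℝ ∞ φ), ⋂ (_ : T φ), ⋂ (i : Fin N),
      {u | inner ℂ ((smoothPair φ hφ).snd i) u.fst =
        -inner ℂ (smoothPair φ hφ).fst (u.snd i)} := by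
    ext u; simp [weakGradientSpace, WeakGradientAgainst]
  rw [this]
  refine isClosed_iInter fun φ => isClosed_iInter fun hφ => isClosed_iInter fun _ =>
    isClosed_iInter fun i => isClosed_eq ?_ ?_
  · exact continuous_const.inner (WithLp.prod_continuous_ofLp 2 _ _).fst
  · exact (continuous_const.inner ((PiLp.continuous_apply 2 _ i).comp
      (WithLp.prod_continuous_ofLp 2 _ _).snd)).neg

theorem inner_toLp {N : ℕ} {φ ψ : (Fin N → ℝ) → ℂ} (hφ : Continuous φ) (hψ : Continuous ψ) :
    inner ℂ ((memLp_of_continuous hφ).toLp φ) ((memLp_of_continuous hψ).toLp ψ) =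
      ∫ x in cube N, star (φ x) * ψ x := by
  rw [L2.inner_def]
  refine integral_congr_ae ?_
  filter_upwards [(memLp_of_continuous hφ).coeFn_toLp, (memLp_of_continuous hψ).coeFn_toLp]
    with x h1 h2
  rw [h1, h2, RCLike.inner_apply, mul_comm]
  rfl

/-- Integration by parts against a test function on the cube. -/
theorem smoothPair_mem_H1per {N : ℕ} {φ : (Fin N → ℝ) → ℂ} (hφ : IsTestFunction φ) :
    smoothPair φ hφ.1 ∈ H1per N := by
  intro ψ hψ _ i
  have hcψ : Continuous (fun x => star (ψ x)) := continuous_star.comp hψ.continuous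
  have hcψ' : Continuous (fun x => star (partialDeriv i ψ x)) :=
    continuous_star.comp (contDiff_partialDeriv hψ i).continuous
  have hsub : tsupport (partialDeriv i φ) ⊆ tsupport φ := by
    refine (closure_mono fun x hx => ?_).trans (tsupport_fderiv_subset ℝ)
    exact fun h => hx (by simp [partialDeriv, h])
  have hcs' : HasCompactSupport (partialDeriv i φ) :=
    hφ.2.1.of_isClosed_subset (isClosed_tsupport _) hsub
  have hz : ∀ x, x ∉ cube N → φ x = 0 := fun x hx =>
    image_eq_zero_of_notMem_tsupport fun h => hx (hφ.2.2 h)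
  have hz' : ∀ x, x ∉ cube N → partialDeriv i φ x = 0 := fun x hx =>
    image_eq_zero_of_notMem_tsupport fun h => hx (hφ.2.2 (hsub h))
  have hd : ∀ x, fderiv ℝ (fun y => star (ψ y)) x (Pi.single i 1) = star (partialDeriv i ψ x) := by
    intro x
    rw [fderiv_star]
    rfl
  have key := integral_mul_fderiv_eq_neg_fderiv_mul_of_integrable (μ := volume)
    (f := fun x => star (ψ x)) (g := φ) (v := (Pi.single i 1 : Fin N → ℝ))
    (by
      simp only [hd]
      exact (hcψ'.mul hφ.1.continuous).integrable_of_hasCompactSupport hφ.2.1.mul_left)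
    ((hcψ.mul (contDiff_partialDeriv hφ.1 i).continuous).integrable_of_hasCompactSupport
      hcs'.mul_left)
    ((hcψ.mul hφ.1.continuous).integrable_of_hasCompactSupport hφ.2.1.mul_left)
    (fun x _ => ((hψ.differentiable (by simp)) x).star)
    (fun x _ => (hφ.1.differentiable (by simp)) x)
  simp only [hd] at key
  have e1 : inner ℂ ((smoothPair ψ hψ).snd i) (smoothPair φ hφ.1).fst =
      ∫ x, star (partialDeriv i ψ x) * φ x := by
    refine (inner_toLp (contDiff_partialDeriv hψ i).continuous hφ.1.continuous).trans ?_
    exact setIntegral_eq_integral_of_forall_compl_eq_zero fun x hx => by rw [hz x hx, mul_zero]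
  have e2 : inner ℂ (smoothPair ψ hψ).fst ((smoothPair φ hφ.1).snd i) =
      ∫ x, star (ψ x) * partialDeriv i φ x := by
    refine (inner_toLp hψ.continuous (contDiff_partialDeriv hφ.1 i).continuous).trans ?_
    exact setIntegral_eq_integral_of_forall_compl_eq_zero fun x hx => by rw [hz' x hx, mul_zero]
  rw [e1, e2]
  exact (neg_eq_iff_eq_neg.2 key).symm

theorem H10_le_H1per (N : ℕ) : H10 N ≤ H1per N := by
  refine Submodule.topologicalClosure_minimal _ (Submodule.span_le.2 ?_)
    (isClosed_weakGradientSpace _)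
  rintro _ ⟨φ, hφ, rfl⟩
  exact smoothPair_mem_H1per hφ

/-! ### Negative order spaces -/

/-- The space `H¹(T^N)` as a Hilbert space in its own right, with the `H¹`-inner product. -/
def TorusH1 (N : ℕ) : Type := H1per N

instance (N : ℕ) : NormedAddCommGroup (TorusH1 N) := inferInstanceAs (NormedAddCommGroup (H1per N))

instance (N : ℕ) : InnerProductSpace ℂ (TorusH1 N) :=
  inferInstanceAs (InnerProductSpace ℂ (H1per N))

/-- The pair `(u, ∇u)` of an element `u` of `H¹(T^N)`. -/
def TorusH1.pair {N : ℕ} : TorusH1 N →L[ℂ] Pairs N := (H1per N).subtypeL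

/-- The inclusion of `H¹₀((0,1)^N)` in `H¹(T^N)`. -/
def H10toTorus {N : ℕ} (g : H10 N) : TorusH1 N := ⟨g, H10_le_H1per N g.2⟩

/-- `H⁻¹(T^N)`, the space of continuous antilinear functionals on `H¹(T^N)`, with the dual norm.
Antilinearity makes the embedding of `L²` linear. -/
abbrev DualTorusH1 (N : ℕ) := TorusH1 N →L⋆[ℂ] ℂ

/-- The functionals in `H⁻¹(T^N)` that annihilate `Har(T^N)`. -/
def annHarPer (N : ℕ) : Submodule ℂ (DualTorusH1 N) where
  carrier := {w | ∀ v : TorusH1 N, v.pair ∈ HarPer N → w v = 0}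
  zero_mem' := fun _ _ => rfl
  add_mem' := fun {w z} hw hz v hv => by
    rw [add_apply, hw v hv, hz v hv, add_zero]
  smul_mem' := fun c {w} hw v hv => by
    rw [smul_apply, hw v hv, smul_zero]

/-- The space `H`, the annihilator of `Har(T^N)`, with the norm of `H⁻¹(T^N)`. -/
def H (N : ℕ) : Type := annHarPer N

instance (N : ℕ) : NormedAddCommGroup (H N) := inferInstanceAs (NormedAddCommGroup (annHarPer N))

instance (N : ℕ) : NormedSpace ℂ (H N) := inferInstanceAs (NormedSpace ℂ (annHarPer N))

/-- The element of `H⁻¹(T^N)` underlying an element of `H`. -/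
def H.toDual {N : ℕ} : H N →L[ℂ] DualTorusH1 N := (annHarPer N).subtypeL

/-- The embedding of `L²((0,1)^N)` in `H⁻¹(T^N)`, `f ↦ (v ↦ ∫ f v‾)`. -/
def L2toDual (N : ℕ) : L2 N →L[ℂ] DualTorusH1 N :=
  LinearMap.mkContinuous
    { toFun := fun f => (innerSLFlip ℂ f).comp
        ((WithLp.fstL 2 ℂ (L2 N) (PiLp 2 fun _ : Fin N => L2 N)).comp TorusH1.pair)
      map_add' := fun f g => by ext v; simp
      map_smul' := fun c f => by ext v; simp }
    1 fun f => by
      refine ContinuousLinearMap.opNorm_le_bound _ (by positivity) fun v => ?_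
      refine (norm_inner_le_norm (TorusH1.pair v).fst f).trans ?_
      rw [one_mul, mul_comm]
      exact mul_le_mul_of_nonneg_left (WithLp.norm_fst_le _ (TorusH1.pair v)) (norm_nonneg _)

theorem L2toDual_apply {N : ℕ} (f : L2 N) (v : TorusH1 N) :
    L2toDual N f v = inner ℂ v.pair.fst f := rfl

/-- The space `V` of the `f ∈ L²((0,1)^N)` that are orthogonal to `Har((0,1)^N)`. -/
def V (N : ℕ) : Submodule ℂ (L2 N) where
  carrier := {f | ∀ h ∈ Har N, inner ℂ h.fst f = 0}
  zero_mem' := fun h _ => by simp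
  add_mem' := fun {f g} hf hg h hh => by rw [inner_add_right, hf h hh, hg h hh, add_zero]
  smul_mem' := fun c {f} hf h hh => by rw [inner_smul_right, hf h hh, mul_zero]

/-- The embedding of `V` in `H`. -/
def VtoH (N : ℕ) : V N →L[ℂ] H N :=
  ((L2toDual N).comp (V N).subtypeL).codRestrict (annHarPer N) fun f _ hv =>
    f.2 _ (HarPer_le_Har N hv)

/-- `u` is the potential `u_g` of `g ∈ H`: the element of `H¹(T^N)` with mean zero and
`∫ ∇u (∇v)‾ = -⟨g, v⟩` for all `v ∈ H¹(T^N)`. (As `g` annihilates the constants, no mean has to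
be subtracted from it; so `u` is the weak solution of `Δu = g` on the torus.) -/
def IsPotential {N : ℕ} (g : H N) (u : TorusH1 N) : Prop :=
  ∫ x in cube N, u.pair.fst x = 0 ∧
    ∀ v : TorusH1 N, inner ℂ v.pair.snd u.pair.snd = -g.toDual v

/-! ### The operator `A` and its semigroup -/

/-- `f ∈ D(A)` and `A f = g`: here `f ∈ V`, `g ∈ H` and `∫ f h‾ = ∫ ∇u_g (∇u_h)‾` for all
`h ∈ V`, where the right-hand side is the inner product of `g` and `h` in `H`. -/
def IsA {N : ℕ} (f : V N) (g : H N) : Prop :=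
  ∃ ug : TorusH1 N, IsPotential g ug ∧ ∀ h : V N, ∃ uh : TorusH1 N, IsPotential (VtoH N h) uh ∧
    inner ℂ (h : L2 N) (f : L2 N) = inner ℂ uh.pair.snd ug.pair.snd

/-- The domain `D(A)`. -/
def domA (N : ℕ) : Set (V N) := {f | ∃ g : H N, IsA f g}

/-- The graph of the operator `-A` in `H`. -/
def graphNegA (N : ℕ) : Set (H N × H N) :=
  {p | ∃ (f : V N) (g : H N), IsA f g ∧ p = (VtoH N f, -g)}

/-- Strongly continuous one-parameter semigroups of bounded operators. -/
structure IsC0Semigroup {X : Type*} [NormedAddCommGroup X] [NormedSpace ℂ X]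
    (S : ℝ≥0 → X →L[ℂ] X) : Prop where
  map_zero : S 0 = ContinuousLinearMap.id ℂ X
  map_add : ∀ s t, S (s + t) = (S s).comp (S t)
  continuous : ∀ x, Continuous fun t => S t x

/-- The graph of the infinitesimal generator of a semigroup. -/
def generatorGraph {X : Type*} [NormedAddCommGroup X] [NormedSpace ℂ X]
    (S : ℝ≥0 → X →L[ℂ] X) : Set (X × X) :=
  {p | Tendsto (fun t : ℝ≥0 => ((t : ℝ) : ℂ)⁻¹ • (S t p.1 - p.1)) (𝓝[>] 0) (𝓝 p.2)}

/-- `S` is the semigroup `(e^{-tA})_{t ≥ 0}` on `H`: the strongly continuous semigroup whose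
generator is `-A`. -/
def IsExpNegA {N : ℕ} (S : ℝ≥0 → H N →L[ℂ] H N) : Prop :=
  IsC0Semigroup S ∧ generatorGraph S = graphNegA N

/-! ### The distributional Laplacian -/

theorem smoothPair_mem_H10 {N : ℕ} {φ : (Fin N → ℝ) → ℂ} (hφ : IsTestFunction φ) :
    smoothPair φ hφ.1 ∈ H10 N :=
  Submodule.le_topologicalClosure _ (Submodule.subset_span ⟨φ, hφ, rfl⟩)

/-- `D ∈ H⁻¹((0,1)^N)`, the antidual of `H¹₀((0,1)^N)`, is the Laplacian of `f ∈ L²((0,1)^N)` in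
the sense of distributions: `⟨D, φ⟩ = ∫ f (Δφ)‾` for all `φ ∈ C_c^∞((0,1)^N)`. -/
def IsDistribLaplacian {N : ℕ} (f : L2 N) (D : H10 N →L⋆[ℂ] ℂ) : Prop :=
  ∀ (φ : (Fin N → ℝ) → ℂ) (hφ : IsTestFunction φ),
    D ⟨smoothPair φ hφ.1, smoothPair_mem_H10 hφ⟩ =
      ∫ x in cube N, f x * conj (classicalLaplacian φ x)

end HeatCube

end

open HeatCube

noncomputable section

namespace HeatCube

/-! The inverse of `A` is a bounded positive operator once `H` is described by gradients of
potentials. Poincaré's inequality (`norm_fst_le_norm_snd`, a consequence of Parseval's identity)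
makes the gradient injective with closed range on functions of mean zero in `H¹(T^N)`. Riesz's
theorem then gives every `g ∈ H` its potential, and `g ↦ ∇u_g` identifies `H` with the Hilbert space
`potentialFields` (`fieldEquivH`).

Let `J` be the embedding of `V` in this space (`VtoField`). The identity defining `D(A)` says `⟨h,
f⟩ = ⟨J h, ∇u_g⟩` for all `h ∈ V`, that is, `f = J* ∇u_g` (`isA_iff`). So the graph of `-A` is `{(T
a, -a)}` with `T = J J*` (`invA`). The range of `T` is dense (`denseRange_invA`): if `J* p = 0` and
`p = ∇u`, then `u` is orthogonal to `V`, hence to the Laplacians of all test functions. Thus `u ∈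
Har(T^N)`, and `p` is orthogonal to itself.

The semigroup is `exp (-t T⁻¹)`, obtained without unbounded operators as the continuous function
`exp (-t / x)` of `T`. Two scalar estimates, uniform in `x ≥ 0`, control it near `t = 0` on the
ranges of `T` and `T²`; contractivity and density do the rest (`generatorGraph_expNegInvOp`).
Uniqueness is an energy estimate (`eq_expNegInvOp`).

If `u₀ = J* a`, then `u(t) = J* exp (-t T⁻¹) a`. It lies in `V`, which gives the orthogonality to
harmonic functions and, for constants and coordinates, the moments. Moreover `∂ₜu = -A u(t)`, and
taking `h = Δφ` in the identity defining `A` shows that this is `Δu(t)` on `H¹₀`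
(`isDistribLaplacian_of_isA`). -/

/-! ### The functions `x ↦ exp (-t / x)` -/

/-- The function `x ↦ exp (-t / x)`, extended by `0` to `x ≤ 0` if `t ≠ 0`, and by `1` if
`t = 0`. -/
def expNegDiv (t x : ℝ) : ℝ := if t = 0 then 1 else expNegInvGlue (x / t)

theorem expNegDiv_zero_left (x : ℝ) : expNegDiv 0 x = 1 := if_pos rfl

/-- Continuity at `x = 0` is what matters: `0` may belong to the spectrum of `T`, and the continuous
functional calculus needs a continuous function there. -/
theorem continuous_expNegDiv (t : ℝ) : Continuous (expNegDiv t) := by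
  unfold expNegDiv
  split_ifs
  · exact continuous_const
  · exact (expNegInvGlue.contDiff (n := 0)).continuous.comp (continuous_id.div_const t)

theorem expNegDiv_of_pos {t x : ℝ} (ht : 0 ≤ t) (hx : 0 < x) :
    expNegDiv t x = Real.exp (-(t / x)) := by
  unfold expNegDiv
  split_ifs with h
  · simp [h]
  · have : 0 < x / t := div_pos hx (lt_of_le_of_ne ht (Ne.symm h))
    rw [expNegInvGlue, if_neg (not_le.2 this), inv_div]

theorem expNegDiv_zero_right {t : ℝ} (ht : t ≠ 0) : expNegDiv t 0 = 0 := by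
  simp [expNegDiv, ht, expNegInvGlue]

theorem expNegDiv_add {s t x : ℝ} (hs : 0 ≤ s) (ht : 0 ≤ t) (hx : 0 ≤ x) :
    expNegDiv (s + t) x = expNegDiv s x * expNegDiv t x := by
  rcases hx.eq_or_lt with rfl | hx
  · rcases hs.eq_or_lt with rfl | hs
    · simp [expNegDiv_zero_left]
    · rw [expNegDiv_zero_right hs.ne', expNegDiv_zero_right (add_pos_of_pos_of_nonneg hs ht).ne',
        zero_mul]
  · rw [expNegDiv_of_pos (add_nonneg hs ht) hx, expNegDiv_of_pos hs hx, expNegDiv_of_pos ht hx,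
      ← Real.exp_add]
    ring_nf

theorem abs_expNegDiv_le {t x : ℝ} (ht : 0 ≤ t) (hx : 0 ≤ x) : |expNegDiv t x| ≤ 1 := by
  rcases hx.eq_or_lt with rfl | hx
  · by_cases h : t = 0
    · simp [h, expNegDiv_zero_left]
    · simp [expNegDiv_zero_right h]
  · rw [expNegDiv_of_pos ht hx, abs_of_pos (Real.exp_pos _), Real.exp_le_one_iff]
    exact neg_nonpos.2 (by positivity)

theorem exp_neg_le {s : ℝ} (hs : 0 ≤ s) : Real.exp (-s) ≤ 1 - s + s ^ 2 := by
  have h1 : Real.exp (-s) * (1 + s) ≤ 1 := by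
    calc Real.exp (-s) * (1 + s) ≤ Real.exp (-s) * Real.exp s := by
          gcongr; linarith [Real.add_one_le_exp s]
      _ = 1 := by rw [← Real.exp_add]; simp
  -- `(1 - s + s²)(1 + s) = 1 + s³ ≥ 1`.
  nlinarith [pow_nonneg hs 3]

/-- With `s = t / x`, multiply `-s ≤ exp (-s) - 1 ≤ 0` by `x`. One factor `x` absorbs the
singularity of `t / x`, so orbits starting in the range of `T` are Lipschitz in time. -/
theorem abs_expNegDiv_mul_sub_le {t x : ℝ} (ht : 0 ≤ t) (hx : 0 ≤ x) :
    |expNegDiv t x * x - x| ≤ t := by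
  rcases hx.eq_or_lt with rfl | hx
  · simpa using ht
  · rw [expNegDiv_of_pos ht hx]
    have h0 : 0 ≤ t / x := by positivity
    have h1 := Real.add_one_le_exp (-(t / x))
    have h2 : Real.exp (-(t / x)) ≤ 1 := Real.exp_le_one_iff.2 (neg_nonpos.2 h0)
    have h3 : t / x * x = t := div_mul_cancel₀ _ hx.ne'
    rw [abs_le]
    constructor <;> nlinarith

/-- With `s = t / x`, multiply `0 ≤ exp (-s) - 1 + s ≤ s²` by `x²`. This yields the derivative at
time `0` on the range of `T²`, with a quadratic error. -/
theorem abs_expNegDiv_mul_sq_sub_le {t x : ℝ} (ht : 0 ≤ t) (hx : 0 ≤ x) :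
    |expNegDiv t x * x ^ 2 - x ^ 2 + t * x| ≤ t ^ 2 := by
  rcases hx.eq_or_lt with rfl | hx
  · simpa using sq_nonneg t
  · rw [expNegDiv_of_pos ht hx]
    have h0 : 0 ≤ t / x := by positivity
    have h1 := Real.add_one_le_exp (-(t / x))
    have h2 := exp_neg_le h0
    have h3 : t = t / x * x := (div_mul_cancel₀ _ hx.ne').symm
    generalize t / x = s at *
    subst h3
    have hx2 : 0 ≤ x ^ 2 := sq_nonneg x
    rw [abs_le]
    constructor <;> nlinarith

/-! ### The semigroup generated by the inverse of a positive operator -/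

section Semigroup

variable {G : Type*} [NormedAddCommGroup G] [InnerProductSpace ℂ G] [CompleteSpace G]
  {T : G →L[ℂ] G}

/-- The operators `exp (-t T⁻¹)`, for a positive operator `T` with dense range. -/
def expNegInvOp (T : G →L[ℂ] G) (t : ℝ≥0) : G →L[ℂ] G := cfc (expNegDiv t) T

theorem spectrum_real_nonneg (hT : T.IsPositive) {x : ℝ} (hx : x ∈ spectrum ℝ T) : 0 ≤ x :=
  spectrum_nonneg_of_nonneg ((ContinuousLinearMap.nonneg_iff_isPositive T).2 hT) hx

theorem expNegInvOp_zero (hT : T.IsPositive) :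
    expNegInvOp T 0 = ContinuousLinearMap.id ℂ G := by
  have hs : IsSelfAdjoint T := hT.isSelfAdjoint
  have : expNegDiv ((0 : ℝ≥0) : ℝ) = fun _ => (1 : ℝ) := funext expNegDiv_zero_left
  rw [expNegInvOp, this, cfc_const_one ℝ T]
  rfl

theorem expNegInvOp_add (hT : T.IsPositive) (s t : ℝ≥0) :
    expNegInvOp T (s + t) = (expNegInvOp T s).comp (expNegInvOp T t) := by
  have hs : IsSelfAdjoint T := hT.isSelfAdjoint
  have h := cfc_mul (expNegDiv s) (expNegDiv t) T (continuous_expNegDiv _).continuousOn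
    (continuous_expNegDiv _).continuousOn
  refine Eq.trans ?_ h
  refine cfc_congr fun x hx => ?_
  push_cast
  exact expNegDiv_add s.2 t.2 (spectrum_real_nonneg hT hx)

theorem norm_expNegInvOp_le (hT : T.IsPositive) (t : ℝ≥0) : ‖expNegInvOp T t‖ ≤ 1 :=
  norm_cfc_le zero_le_one fun _ hx => abs_expNegDiv_le t.2 (spectrum_real_nonneg hT hx)

theorem norm_expNegInvOp_apply_le (hT : T.IsPositive) (t : ℝ≥0) (x : G) :
    ‖expNegInvOp T t x‖ ≤ ‖x‖ := by
  simpa using (expNegInvOp T t).le_of_opNorm_le (norm_expNegInvOp_le hT t) x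

theorem expNegInvOp_comm (hT : T.IsPositive) (t : ℝ≥0) (x : G) :
    expNegInvOp T t (T x) = T (expNegInvOp T t x) := by
  have hs : IsSelfAdjoint T := hT.isSelfAdjoint
  have h := (cfc_commute_cfc (expNegDiv t) (fun x => x) T).eq
  rw [cfc_id' ℝ T] at h
  exact congrArg (fun B : G →L[ℂ] G => B x) h

theorem norm_expNegInvOp_mul_sub_le (hT : T.IsPositive) (t : ℝ≥0) (x : G) :
    ‖expNegInvOp T t (T x) - T x‖ ≤ t * ‖x‖ := by
  have hs : IsSelfAdjoint T := hT.isSelfAdjoint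
  have h : cfc (fun x => expNegDiv t x * x - x) T = expNegInvOp T t * T - T := by
    rw [cfc_sub (fun x => expNegDiv t x * x) (fun x => x) T
      ((continuous_expNegDiv _).mul continuous_id).continuousOn continuousOn_id,
      cfc_mul (expNegDiv t) (fun x => x) T (continuous_expNegDiv _).continuousOn continuousOn_id,
      cfc_id' ℝ T]
    rfl
  have hn : ‖expNegInvOp T t * T - T‖ ≤ t := by
    rw [← h]
    exact norm_cfc_le t.2 fun x hx =>
      abs_expNegDiv_mul_sub_le t.2 (spectrum_real_nonneg hT hx)
  exact (expNegInvOp T t * T - T).le_of_opNorm_le hn x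

theorem norm_expNegInvOp_mul_sq_sub_le (hT : T.IsPositive) (t : ℝ≥0) (x : G) :
    ‖expNegInvOp T t (T (T x)) - T (T x) + (t : ℂ) • T x‖ ≤ (t : ℝ) ^ 2 * ‖x‖ := by
  have hs : IsSelfAdjoint T := hT.isSelfAdjoint
  have h : cfc (fun x => expNegDiv t x * x ^ 2 - x ^ 2 + t * x) T =
      expNegInvOp T t * T ^ 2 - T ^ 2 + (t : ℝ) • T := by
    rw [cfc_add T (fun x => expNegDiv t x * x ^ 2 - x ^ 2) (fun x => t * x)
      (((continuous_expNegDiv _).mul (continuous_id.pow 2)).sub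
        (continuous_id.pow 2)).continuousOn (continuous_const.mul continuous_id).continuousOn,
      cfc_sub (fun x => expNegDiv t x * x ^ 2) (fun x => x ^ 2) T
      ((continuous_expNegDiv _).mul (continuous_id.pow 2)).continuousOn
      (continuous_id.pow 2).continuousOn,
      cfc_mul (expNegDiv t) (fun x => x ^ 2) T (continuous_expNegDiv _).continuousOn
      (continuous_id.pow 2).continuousOn, cfc_pow_id T 2, cfc_const_mul_id (t : ℝ) T]
    rfl
  have hn : ‖expNegInvOp T t * T ^ 2 - T ^ 2 + (t : ℝ) • T‖ ≤ (t : ℝ) ^ 2 := by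
    rw [← h]
    exact norm_cfc_le (sq_nonneg _) fun x hx =>
      abs_expNegDiv_mul_sq_sub_le t.2 (spectrum_real_nonneg hT hx)
  have := (expNegInvOp T t * T ^ 2 - T ^ 2 + (t : ℝ) • T).le_of_opNorm_le hn x
  rw [pow_two T] at this
  simpa using this

/-- Orbits of points `T b` are Lipschitz; since the operators are contractions, they approximate any
other orbit uniformly in time. -/
theorem continuous_expNegInvOp_apply (hT : T.IsPositive) (hd : DenseRange T) (x : G) :
    Continuous fun t => expNegInvOp T t x := by
  have hlip : ∀ b : G, Continuous fun t => expNegInvOp T t (T b) := by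
    intro b
    have aux : ∀ s t : ℝ≥0, s ≤ t →
        dist (expNegInvOp T s (T b)) (expNegInvOp T t (T b)) ≤ ‖b‖₊ * dist s t := by
      intro s t hst
      obtain ⟨r, rfl⟩ := exists_add_of_le hst
      rw [expNegInvOp_add hT, dist_comm, dist_eq_norm, ContinuousLinearMap.comp_apply, ← map_sub]
      refine (norm_expNegInvOp_apply_le hT _ _).trans
        ((norm_expNegInvOp_mul_sub_le hT r b).trans (le_of_eq ?_))
      rw [NNReal.dist_eq]
      push_cast
      rw [sub_add_cancel_left, abs_neg, NNReal.abs_eq, mul_comm]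
    refine (LipschitzWith.of_dist_le_mul (K := ‖b‖₊) fun s t => ?_).continuous
    rcases le_total s t with h | h
    · exact aux s t h
    · rw [dist_comm, dist_comm s t]; exact aux t s h
  refine continuous_of_uniform_approx_of_continuous fun u hu => ?_
  obtain ⟨ε, hε, hu⟩ := Metric.mem_uniformity_dist.1 hu
  obtain ⟨b, hb⟩ := hd.exists_dist_lt x hε
  refine ⟨_, hlip b, fun t => hu ?_⟩
  rw [dist_eq_norm, ← map_sub]
  exact (norm_expNegInvOp_apply_le hT _ _).trans_lt (by rwa [← dist_eq_norm])

theorem isC0Semigroup_expNegInvOp (hT : T.IsPositive) (hd : DenseRange T) :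
    IsC0Semigroup (expNegInvOp T) :=
  ⟨expNegInvOp_zero hT, expNegInvOp_add hT, continuous_expNegInvOp_apply hT hd⟩

/-- Approximate `a` by `T b`. On `T (T b)` the second-order estimate gives the limit; the error `a -
T b` enters the difference quotient with a factor bounded independently of `t`, by the first-order
estimate. -/
theorem tendsto_expNegInvOp_quotient (hT : T.IsPositive) (hd : DenseRange T) (a : G) :
    Tendsto (fun t : ℝ≥0 => ((t : ℝ) : ℂ)⁻¹ • (expNegInvOp T t (T a) - T a)) (𝓝[>] 0)
      (𝓝 (-a)) := by
  have hn : ∀ t : ℝ≥0, 0 < t → ‖((t : ℝ) : ℂ)⁻¹‖ = (t : ℝ)⁻¹ := fun t ht => by simp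
  have key : ∀ (b : G) (t : ℝ≥0), 0 < t →
      ‖((t : ℝ) : ℂ)⁻¹ • (expNegInvOp T t (T a) - T a) - -a‖ ≤ 2 * ‖a - T b‖ + t * ‖b‖ := by
    intro b t ht
    have ht' : (0 : ℝ) < t := ht
    have htc : ((t : ℝ) : ℂ) ≠ 0 := by exact_mod_cast ht'.ne'
    have e : ((t : ℝ) : ℂ)⁻¹ • (expNegInvOp T t (T a) - T a) - -a =
        ((t : ℝ) : ℂ)⁻¹ • (expNegInvOp T t (T (a - T b)) - T (a - T b)) + (a - T b) +
        ((t : ℝ) : ℂ)⁻¹ • (expNegInvOp T t (T (T b)) - T (T b) + ((t : ℝ) : ℂ) • T b) := by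
      rw [smul_add, inv_smul_smul₀ htc]
      simp only [map_sub, smul_sub]
      abel
    rw [e]
    have h1 : ‖((t : ℝ) : ℂ)⁻¹ • (expNegInvOp T t (T (a - T b)) - T (a - T b))‖ ≤ ‖a - T b‖ := by
      rw [norm_smul, hn t ht, inv_mul_le_iff₀ ht']
      exact norm_expNegInvOp_mul_sub_le hT t _
    have h2 : ‖((t : ℝ) : ℂ)⁻¹ • (expNegInvOp T t (T (T b)) - T (T b) + ((t : ℝ) : ℂ) • T b)‖ ≤
        t * ‖b‖ := by
      rw [norm_smul, hn t ht, inv_mul_le_iff₀ ht', ← mul_assoc, ← sq]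
      exact norm_expNegInvOp_mul_sq_sub_le hT t _
    refine (norm_add₃_le).trans ?_
    linarith
  rw [Metric.tendsto_nhds]
  intro ε hε
  obtain ⟨b, hb⟩ := hd.exists_dist_lt a (show 0 < ε / 4 by positivity)
  have hsmall : ∀ᶠ t : ℝ≥0 in 𝓝[>] 0, (t : ℝ) * ‖b‖ < ε / 4 := by
    have : Tendsto (fun t : ℝ≥0 => (t : ℝ) * ‖b‖) (𝓝[>] 0) (𝓝 (((0 : ℝ≥0) : ℝ) * ‖b‖)) :=
      ((NNReal.continuous_coe.mul continuous_const).tendsto 0).mono_left nhdsWithin_le_nhds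
    exact this.eventually (gt_mem_nhds (by simpa using by positivity))
  filter_upwards [hsmall, self_mem_nhdsWithin] with t h1 h2
  rw [dist_eq_norm] at hb ⊢
  have := key b t h2
  linarith

/-- Nothing else lies in the generator: if the quotients of `y` tend to `z`, applying `T` gives the
quotients of `T y`, which tend to `-y`. So `T z = -y`. -/
theorem generatorGraph_expNegInvOp (hT : T.IsPositive) (hd : DenseRange T) :
    generatorGraph (expNegInvOp T) = {p | ∃ a, p = (T a, -a)} := by
  ext ⟨y, z⟩
  constructor
  · intro h
    have h1 : Tendsto (fun t : ℝ≥0 => T (((t : ℝ) : ℂ)⁻¹ • (expNegInvOp T t y - y))) (𝓝[>] 0)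
      (𝓝 (T z)) := (T.continuous.tendsto z).comp h
    have h2 := tendsto_expNegInvOp_quotient hT hd y
    simp only [map_smul, map_sub, ← expNegInvOp_comm hT] at h1
    have h3 : T z = -y := tendsto_nhds_unique h1 h2
    exact ⟨-z, by simp [h3]⟩
  · rintro ⟨a, ha⟩
    obtain ⟨rfl, rfl⟩ := Prod.mk.inj ha
    exact tendsto_expNegInvOp_quotient hT hd a

theorem tendsto_nhdsGT_coe_nnreal {X : Type*} {l : Filter X} {f : ℝ≥0 → X} (t : ℝ≥0)
    (h : Tendsto f (𝓝[>] 0) l) :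
    Tendsto (fun s : ℝ => f (s - t).toNNReal) (𝓝[>] (t : ℝ)) l := by
  refine h.comp (tendsto_nhdsWithin_iff.2 ⟨?_, ?_⟩)
  · have : Continuous fun s : ℝ => (s - t).toNNReal :=
      continuous_real_toNNReal.comp (continuous_id.sub continuous_const)
    simpa using (this.tendsto (t : ℝ)).mono_left nhdsWithin_le_nhds
  · filter_upwards [self_mem_nhdsWithin] with s hs
    exact Real.toNNReal_pos.2 (sub_pos.2 hs)

/-- The orbit of an element of the domain of the generator has the expected right derivative. -/
theorem IsC0Semigroup.hasDerivWithinAt_Ioi {X : Type*} [NormedAddCommGroup X] [NormedSpace ℂ X]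
    {S : ℝ≥0 → X →L[ℂ] X} (hS : IsC0Semigroup S) {x y : X} (h : (x, y) ∈ generatorGraph S)
    (t : ℝ≥0) : HasDerivWithinAt (fun s : ℝ => S s.toNNReal x) (S t y) (Set.Ioi t) t := by
  rw [hasDerivWithinAt_iff_tendsto_slope' (by simp)]
  have h1 := tendsto_nhdsGT_coe_nnreal t (((S t).continuous.tendsto y).comp h)
  refine h1.congr' ?_
  filter_upwards [self_mem_nhdsWithin] with s hs
  have hs' : (t : ℝ) < s := hs
  have e : s.toNNReal = t + (s - t).toNNReal := by
    rw [← NNReal.coe_inj, NNReal.coe_add, Real.coe_toNNReal _ (t.2.trans hs'.le),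
      Real.coe_toNNReal _ (sub_nonneg.2 hs'.le)]
    ring
  simp only [slope, vsub_eq_sub, Function.comp, map_smul, map_sub, Real.toNNReal_coe]
  rw [e, hS.map_add, Real.coe_toNNReal _ (sub_nonneg.2 hs'.le), ← Complex.ofReal_inv,
    Complex.coe_smul]
  rfl

/-! ### Uniqueness of the semigroup and two-sided differentiability of orbits -/

theorem generatorGraph_invariant {X : Type*} [NormedAddCommGroup X] [NormedSpace ℂ X]
    {S : ℝ≥0 → X →L[ℂ] X} (hS : IsC0Semigroup S) {x y : X} (h : (x, y) ∈ generatorGraph S)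
    (t : ℝ≥0) : (S t x, S t y) ∈ generatorGraph S := by
  have h1 := ((S t).continuous.tendsto y).comp h
  refine h1.congr fun s => ?_
  have e : S s (S t x) = S t (S s x) := by
    rw [← ContinuousLinearMap.comp_apply, ← ContinuousLinearMap.comp_apply, ← hS.map_add,
      ← hS.map_add, add_comm]
  simp only [Function.comp, map_smul, map_sub, e]

/-- Energy estimate: the difference `w` of two orbits starting at `T a` satisfies `w = -T w'`. Hence
the right derivative of `‖w‖²` is `-2 ⟨T w', w'⟩ ≤ 0`, while `w(0) = 0`. No growth bound on `S` is
needed. -/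
theorem eq_expNegInvOp (hT : T.IsPositive) (hd : DenseRange T) {S : ℝ≥0 → G →L[ℂ] G}
    (hS : IsC0Semigroup S) (hg : generatorGraph S = {p | ∃ a, p = (T a, -a)}) :
    S = expNegInvOp T := by
  have hE := isC0Semigroup_expNegInvOp hT hd
  have hEg := generatorGraph_expNegInvOp hT hd
  -- `S t` preserves the graph of its generator, so `(S t (T a), -S t a)` is again of the form `(T
  -- b, -b)`.
  have hcl : ∀ a t, T (S t a) = S t (T a) := by
    intro a t
    have hm : (T a, -a) ∈ generatorGraph S := hg ▸ ⟨a, rfl⟩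
    have := generatorGraph_invariant hS hm t
    rw [hg] at this
    obtain ⟨b, hb⟩ := this
    obtain ⟨h1, h2⟩ := Prod.mk.inj hb
    rw [h1, map_neg, neg_inj] at *
    rw [h2]
  have key : ∀ a t, S t (T a) = expNegInvOp T t (T a) := by
    intro a t
    let w : ℝ → G := fun s => S s.toNNReal (T a) - expNegInvOp T s.toNNReal (T a)
    let w' : ℝ → G := fun s => S s.toNNReal (-a) - expNegInvOp T s.toNNReal (-a)
    have hww' : ∀ s, w s = -T (w' s) := by
      intro s
      simp only [w, w', map_sub, map_neg, hcl, expNegInvOp_comm hT]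
      abel
    have hw : Continuous w :=
      ((hS.continuous _).comp continuous_real_toNNReal).sub
        ((hE.continuous _).comp continuous_real_toNNReal)
    have hder : ∀ s : ℝ, 0 ≤ s → HasDerivWithinAt w (w' s) (Set.Ici s) s := by
      intro s hs
      have h1 := hS.hasDerivWithinAt_Ioi (x := T a) (y := -a) (hg ▸ ⟨a, rfl⟩) s.toNNReal
      have h2 := hE.hasDerivWithinAt_Ioi (x := T a) (y := -a) (hEg ▸ ⟨a, rfl⟩) s.toNNReal
      rw [Real.coe_toNNReal _ hs] at h1 h2
      exact (h1.sub h2).Ici_of_Ioi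
    have hφ : ∀ s ∈ Set.Ico (0 : ℝ) t, HasDerivWithinAt (fun r => Complex.re (inner ℂ (w r) (w r)))
        (Complex.re (inner ℂ (w s) (w' s) + inner ℂ (w' s) (w s))) (Set.Ici s) s := by
      intro s hs
      have := (hder s hs.1).inner ℂ (hder s hs.1)
      exact (Complex.reCLM.hasFDerivAt.comp_hasDerivWithinAt s this)
    have hfin := image_le_of_deriv_right_le_deriv_boundary
      (f := fun r => Complex.re (inner ℂ (w r) (w r))) (a := 0) (b := t)
      (Complex.continuous_re.comp (hw.inner hw)).continuousOn hφ
      (B := fun _ => 0) (B' := fun _ => 0) (by simp [w, hS.map_zero, hE.map_zero])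
      continuousOn_const (fun x _ => hasDerivWithinAt_const _ _ _) (by
        intro s _
        rw [hww' s, inner_neg_left, inner_neg_right, Complex.add_re, Complex.neg_re,
          Complex.neg_re]
        have h1 := hT.re_inner_nonneg_left (w' s)
        have h2 := hT.re_inner_nonneg_right (w' s)
        simp only [RCLike.re_eq_complex_re] at h1 h2
        linarith) (Set.right_mem_Icc.2 t.2)
    have hz : w t = 0 := by
      have h := hfin
      have e : Complex.re (inner ℂ (w t) (w t)) = ‖w t‖ ^ 2 := inner_self_eq_norm_sq (𝕜 := ℂ) (w t)
      simp only [e] at h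
      exact norm_eq_zero.1 (pow_eq_zero_iff two_ne_zero |>.1 (le_antisymm h (sq_nonneg _)))
    simpa [w, sub_eq_zero] using hz
  funext t
  ext x
  exact congrFun (hd.equalizer (S t).continuous (expNegInvOp T t).continuous
    (funext fun a => key a t)) x

/-- The right derivative exists for every semigroup. For `s < t` the slope is the operator at time
`s` applied to the quotient at `0` with step `t - s`; contractivity lets this quotient be replaced
by its limit `-a`, and strong continuity lets `s` tend to `t`. -/
theorem hasDerivAt_expNegInvOp (hT : T.IsPositive) (hd : DenseRange T) (a : G) {t : ℝ≥0}
    (ht : 0 < t) :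
    HasDerivAt (fun s : ℝ => expNegInvOp T s.toNNReal (T a)) (expNegInvOp T t (-a)) (t : ℝ) := by
  have hE := isC0Semigroup_expNegInvOp hT hd
  have hq : Tendsto (fun r : ℝ≥0 => ((r : ℝ) : ℂ)⁻¹ • (expNegInvOp T r (T a) - T a))
    (𝓝[>] 0) (𝓝 (-a)) := tendsto_expNegInvOp_quotient hT hd a
  rw [hasDerivAt_iff_tendsto_slope_left_right]
  refine ⟨?_, ?_⟩
  · have h1 : Tendsto (fun s : ℝ => (t - s).toNNReal) (𝓝[<] (t : ℝ)) (𝓝[>] 0) := by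
      refine tendsto_nhdsWithin_iff.2 ⟨?_, ?_⟩
      · have : Continuous fun s : ℝ => (t - s).toNNReal :=
          continuous_real_toNNReal.comp (continuous_const.sub continuous_id)
        simpa using (this.tendsto (t : ℝ)).mono_left nhdsWithin_le_nhds
      · filter_upwards [self_mem_nhdsWithin] with s hs
        exact Real.toNNReal_pos.2 (sub_pos.2 hs)
    have h2 : Tendsto (fun s : ℝ => expNegInvOp T s.toNNReal (-a)) (𝓝[<] (t : ℝ))
        (𝓝 (expNegInvOp T t (-a))) := by
      have := ((hE.continuous (-a)).comp continuous_real_toNNReal).tendsto (t : ℝ)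
      simp only [Function.comp, Real.toNNReal_coe] at this
      exact this.mono_left nhdsWithin_le_nhds
    have h3 : Tendsto (fun s : ℝ => expNegInvOp T s.toNNReal
        ((((t - s).toNNReal : ℝ) : ℂ)⁻¹ • (expNegInvOp T (t - s).toNNReal (T a) - T a) - -a))
        (𝓝[<] (t : ℝ)) (𝓝 0) := by
      have h4 := (hq.comp h1).sub_const (-a)
      rw [sub_self] at h4
      refine squeeze_zero_norm (fun s => norm_expNegInvOp_apply_le hT _ _) ?_
      simpa using h4.norm
    have h5 := h3.add h2
    rw [zero_add] at h5
    refine h5.congr' ?_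
    have hpos : ∀ᶠ s : ℝ in 𝓝[<] (t : ℝ), 0 < s :=
      nhdsWithin_le_nhds (lt_mem_nhds (show (0 : ℝ) < t from ht))
    filter_upwards [self_mem_nhdsWithin, hpos] with s hs hs0
    have hs' : s < t := hs
    have e : t = s.toNNReal + (t - s).toNNReal := by
      rw [← NNReal.coe_inj, NNReal.coe_add, Real.coe_toNNReal _ hs0.le,
        Real.coe_toNNReal _ (sub_nonneg.2 hs'.le)]
      ring
    rw [← map_add, sub_add_cancel, slope, vsub_eq_sub, Real.toNNReal_coe]
    conv_rhs => rw [← neg_sub (t : ℝ) s, inv_neg, neg_smul, ← smul_neg, neg_sub]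
    conv_rhs => enter [2, 1]; rw [e, expNegInvOp_add hT]
    rw [Real.coe_toNNReal _ (sub_nonneg.2 hs'.le), map_smul, map_sub, ← Complex.ofReal_inv,
      Complex.coe_smul]
    rfl
  · have := hE.hasDerivWithinAt_Ioi (x := T a) (y := -a)
      (generatorGraph_expNegInvOp hT hd ▸ ⟨a, rfl⟩) t
    rwa [hasDerivWithinAt_iff_tendsto_slope' (by simp)] at this

end Semigroup

/-! ### Semigroups under linear isomorphisms -/

section Conjugation

variable {X Y : Type*} [NormedAddCommGroup X] [NormedSpace ℂ X] [NormedAddCommGroup Y]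
  [NormedSpace ℂ Y]

/-- The conjugate of a family of operators by a linear isomorphism. -/
def conjOp (e : X ≃L[ℂ] Y) (S : ℝ≥0 → X →L[ℂ] X) (t : ℝ≥0) : Y →L[ℂ] Y :=
  (e : X →L[ℂ] Y).comp ((S t).comp (e.symm : Y →L[ℂ] X))

theorem conjOp_apply (e : X ≃L[ℂ] Y) (S : ℝ≥0 → X →L[ℂ] X) (t : ℝ≥0) (y : Y) :
    conjOp e S t y = e (S t (e.symm y)) := rfl

theorem conjOp_symm_conjOp (e : X ≃L[ℂ] Y) (S : ℝ≥0 → X →L[ℂ] X) :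
    conjOp e.symm (conjOp e S) = S := by
  funext t; ext x; simp [conjOp_apply]

theorem IsC0Semigroup.conjOp {S : ℝ≥0 → X →L[ℂ] X} (hS : IsC0Semigroup S) (e : X ≃L[ℂ] Y) :
    IsC0Semigroup (conjOp e S) where
  map_zero := by ext y; simp [conjOp_apply, hS.map_zero]
  map_add s t := by ext y; simp [conjOp_apply, hS.map_add]
  continuous y := e.continuous.comp (hS.continuous (e.symm y))

theorem mem_generatorGraph_conjOp (e : X ≃L[ℂ] Y) (S : ℝ≥0 → X →L[ℂ] X) (x y : X) :
    (e x, e y) ∈ generatorGraph (conjOp e S) ↔ (x, y) ∈ generatorGraph S := by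
  simp only [generatorGraph, Set.mem_ofPred_eq, conjOp_apply, e.symm_apply_apply, ← map_sub,
    ← map_smul]
  exact e.toHomeomorph.isInducing.tendsto_nhds_iff.symm

theorem generatorGraph_conjOp (e : X ≃L[ℂ] Y) (S : ℝ≥0 → X →L[ℂ] X) :
    generatorGraph (conjOp e S) = (fun p : X × X => (e p.1, e p.2)) '' generatorGraph S := by
  ext ⟨x, y⟩
  constructor
  · intro h
    refine ⟨(e.symm x, e.symm y), ?_, by simp⟩
    rw [← mem_generatorGraph_conjOp e S]
    simpa using h
  · rintro ⟨⟨a, b⟩, h, hab⟩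
    rw [← hab]
    exact (mem_generatorGraph_conjOp e S a b).2 h

end Conjugation

/-! ### Integration over the cube -/

theorem cube_ae_eq_Icc (N : ℕ) : cube N =ᵐ[volume] Set.Icc (0 : Fin N → ℝ) 1 := by
  have := Measure.univ_pi_Ioo_ae_eq_Icc (μ := fun _ : Fin N => (volume : Measure ℝ))
    (f := 0) (g := 1)
  exact this

theorem volume_cube (N : ℕ) : volume (cube N) = 1 := by
  rw [measure_congr (cube_ae_eq_Icc N), Real.volume_Icc_pi]
  simp

/-- The element of `L²` given by a continuous function. -/
abbrev contL2 {N : ℕ} {φ : (Fin N → ℝ) → ℂ} (hφ : Continuous φ) : L2 N :=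
  (memLp_of_continuous hφ).toLp φ

theorem inner_contL2_left {N : ℕ} {φ : (Fin N → ℝ) → ℂ} (hφ : Continuous φ) (f : L2 N) :
    inner ℂ (contL2 hφ) f = ∫ x in cube N, conj (φ x) * f x := by
  rw [L2.inner_def]
  refine integral_congr_ae ?_
  filter_upwards [(memLp_of_continuous hφ).coeFn_toLp] with x h1
  rw [h1, RCLike.inner_apply, mul_comm]

/-- The constant function one as an element of `L²`. -/
def oneL2 (N : ℕ) : L2 N := contL2 (φ := fun _ => (1 : ℂ)) continuous_const

theorem inner_oneL2 {N : ℕ} (f : L2 N) : inner ℂ (oneL2 N) f = ∫ x in cube N, f x := by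
  rw [oneL2, inner_contL2_left]
  simp

theorem inner_oneL2_self (N : ℕ) : inner ℂ (oneL2 N) (oneL2 N) = 1 := by
  have := inner_toLp (N := N) (φ := fun _ => (1 : ℂ)) (ψ := fun _ => (1 : ℂ)) continuous_const
    continuous_const
  refine this.trans ?_
  simp [volume_cube, Measure.real]

/-- The integral of a partial derivative of a periodic function vanishes. -/
theorem integral_partialDeriv_of_periodic {N : ℕ} {φ : (Fin N → ℝ) → ℂ} (hφ : IsSmoothPeriodic φ)
    (i : Fin N) : ∫ x in cube N, partialDeriv i φ x = 0 := by
  rw [setIntegral_congr_set (cube_ae_eq_Icc N)]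
  -- The index `i` forces `N ≥ 1`. The divergence theorem is then applied to the field whose only
  -- nonzero component is the `i`-th, equal to `φ`; the integrals over the two opposite faces cancel
  -- by periodicity.
  obtain ⟨n, rfl⟩ : ∃ n, N = n + 1 := ⟨N - 1, by have := i.2; omega⟩
  have key := integral_divergence_of_hasFDerivAt_off_countable' (0 : Fin (n + 1) → ℝ) 1
    zero_le_one (fun j => if j = i then φ else 0) (fun j => if j = i then fderiv ℝ φ else 0) ∅
    Set.countable_empty
    (fun j => by
      split_ifs
      · exact hφ.1.continuous.continuousOn
      · exact continuousOn_const)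
    (fun x _ j => by
      split_ifs
      · exact ((hφ.1.differentiable (by simp)) x).hasFDerivAt
      · exact hasFDerivAt_const (0 : ℂ) x)
    (by
      refine Continuous.integrableOn_Icc (continuous_finsetSum _ fun j _ => ?_)
      split_ifs
      · exact (contDiff_partialDeriv hφ.1 j).continuous
      · exact continuous_const)
  have e : ∀ x, ∑ j, (if j = i then fderiv ℝ φ else 0) x (Pi.single j 1) = partialDeriv i φ x := by
    intro x
    rw [Finset.sum_eq_single i]
    · simp [partialDeriv]
    · intro j _ hj
      simp [hj]
    · simp
  simp only [e] at key
  rw [key]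
  refine Finset.sum_eq_zero fun j _ => ?_
  rw [sub_eq_zero]
  congr 1
  funext x
  split_ifs with h
  · subst h
    have : j.insertNth (α := fun _ => ℝ) 1 x =
        j.insertNth (α := fun _ => ℝ) 0 x + Pi.single j 1 := by
      funext l
      refine Fin.succAboveCases j ?_ (fun l => ?_) l
      · simp
      · simp [Fin.succAbove_ne]
    simp only [Pi.one_apply, Pi.zero_apply]
    rw [this, hφ.2]
  · rfl

theorem partialDeriv_const {N : ℕ} (i : Fin N) (c : ℂ) :
    partialDeriv i (fun _ => c) = fun _ => 0 := by
  funext x; simp [partialDeriv]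

/-- The constant function one as an element of `H¹`. -/
def onePair (N : ℕ) : Pairs N := smoothPair (fun _ => (1 : ℂ)) contDiff_const

theorem onePair_fst (N : ℕ) : (onePair N).fst = oneL2 N := rfl

theorem contL2_eq_zero {N : ℕ} {φ : (Fin N → ℝ) → ℂ} (hφ : Continuous φ) (h : ∀ x, φ x = 0) :
    contL2 hφ = 0 := by
  obtain rfl : φ = 0 := funext h
  exact MemLp.toLp_zero _

theorem onePair_snd (N : ℕ) : (onePair N).snd = 0 := by
  refine PiLp.ext fun i => ?_
  exact contL2_eq_zero (contDiff_partialDeriv contDiff_const i).continuous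
    fun x => congrFun (partialDeriv_const i 1) x

/-- For a constant with zero gradient, the relation on the torus says that partial derivatives of
periodic functions have integral zero. -/
theorem onePair_mem_H1per (N : ℕ) : onePair N ∈ H1per N := by
  intro φ hφ hT i
  rw [onePair_snd, PiLp.zero_apply, inner_zero_right, neg_zero, onePair_fst,
    ← inner_conj_symm, inner_oneL2]
  have : ∫ x in cube N, ((smoothPair φ hφ).snd i) x = ∫ x in cube N, partialDeriv i φ x :=
    integral_congr_ae (memLp_of_continuous (contDiff_partialDeriv hφ i).continuous).coeFn_toLp
  rw [this, integral_partialDeriv_of_periodic hT, map_zero]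

/-! ### Fourier series on the cube -/

/-- The Fourier character `x ↦ exp (2πi k·x)`. -/
def character {N : ℕ} (k : Fin N → ℤ) (x : Fin N → ℝ) : ℂ :=
  Complex.exp (2 * Real.pi * Complex.I * ∑ i, (k i : ℂ) * (x i : ℂ))

theorem contDiff_character {N : ℕ} (k : Fin N → ℤ) : ContDiff ℝ ∞ (character k) := by
  unfold character
  refine ContDiff.cexp (contDiff_const.mul (ContDiff.sum fun i _ => contDiff_const.mul ?_))
  exact Complex.ofRealCLM.contDiff.comp (contDiff_apply ℝ ℝ i)

theorem character_eq_mFourier {N : ℕ} (k : Fin N → ℤ) (x : Fin N → ℝ) :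
    character k x = UnitAddTorus.mFourier k (fun i => (x i : UnitAddCircle)) := by
  simp only [character, UnitAddTorus.mFourier, ContinuousMap.coe_mk, fourier_coe_apply,
    Complex.ofReal_one, div_one, ← Complex.exp_sum, Finset.mul_sum]
  congr 1
  refine Finset.sum_congr rfl fun i _ => by ring

theorem isSmoothPeriodic_character {N : ℕ} (k : Fin N → ℤ) : IsSmoothPeriodic (character k) := by
  refine ⟨contDiff_character k, fun i x => ?_⟩
  rw [character_eq_mFourier, character_eq_mFourier]
  congr 1
  funext j
  by_cases h : j = i
  · subst h
    simp only [Pi.add_apply, Pi.single_eq_same]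
    exact AddCircle.coe_add_period 1 _
  · simp [Pi.single_eq_of_ne h]

theorem partialDeriv_character {N : ℕ} (k : Fin N → ℤ) (i : Fin N) (x : Fin N → ℝ) :
    partialDeriv i (character k) x = 2 * Real.pi * Complex.I * k i * character k x := by
  have h1 : HasFDerivAt (fun x : Fin N → ℝ => ∑ i, (k i : ℂ) * (x i : ℂ))
      (∑ i, (k i : ℂ) • Complex.ofRealCLM.comp
        (ContinuousLinearMap.proj (R := ℝ) (φ := fun _ => ℝ) i)) x := by
    refine HasFDerivAt.fun_sum fun j _ => HasFDerivAt.const_mul ?_ _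
    exact (Complex.ofRealCLM.comp
      (ContinuousLinearMap.proj (R := ℝ) (φ := fun _ => ℝ) j)).hasFDerivAt
  have h2 := (h1.const_mul (2 * Real.pi * Complex.I)).cexp
  have h3 : HasFDerivAt (character k) _ x := h2
  rw [partialDeriv, h3.fderiv]
  have h4 : ∑ j, (k j : ℂ) * (((Pi.single i 1 : Fin N → ℝ) j : ℝ) : ℂ) = k i := by
    rw [Finset.sum_eq_single i]
    · simp
    · intro j _ hj
      simp [Pi.single_eq_of_ne hj]
    · simp
  simp only [smul_apply, sum_apply, ContinuousLinearMap.comp_apply,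
    ContinuousLinearMap.proj_apply, smul_eq_mul, Complex.ofRealCLM_apply, h4]
  rw [character]
  ring

/-- The normalized Haar measure of the torus. -/
abbrev torusMeasure (N : ℕ) : Measure (UnitAddTorus (Fin N)) :=
  @volume _ (@MeasureSpace.pi _ _ _ fun _ => instMeasureSpaceUnitAddCircle)

/-- The representative of a point of the torus in the half-open cube. -/
def torusToCube {N : ℕ} (y : UnitAddTorus (Fin N)) : Fin N → ℝ :=
  (UnitAddTorus.measurableEquivPiIoc (0 : Fin N → ℝ) y).1

/-- The half-open box of representatives and the open cube differ by a null set. This carries the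
Fourier basis of the torus over to the cube. -/
theorem measurePreserving_torusToCube (N : ℕ) :
    MeasurePreserving (torusToCube (N := N)) (torusMeasure N) (cubeMeasure N) := by
  have h1 := UnitAddTorus.measurePreserving_equivPiIoc (0 : Fin N → ℝ)
  have hm : MeasurableSet {x : Fin N → ℝ | ∀ i, x i ∈ Set.Ioc ((0 : Fin N → ℝ) i)
      ((0 : Fin N → ℝ) i + 1)} := MeasurableSet.univ_pi' fun i => measurableSet_Ioc
  have h2 : MeasurePreserving (Subtype.val : {x : Fin N → ℝ // ∀ i, x i ∈
      Set.Ioc ((0 : Fin N → ℝ) i) ((0 : Fin N → ℝ) i + 1)} → Fin N → ℝ)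
      (Measure.comap Subtype.val volume) (cubeMeasure N) := by
    refine ⟨measurable_subtype_coe, ?_⟩
    refine (map_comap_subtype_coe hm volume).trans (Measure.restrict_congr_set ?_)
    have e : {x : Fin N → ℝ | ∀ i, x i ∈ Set.Ioc ((0 : Fin N → ℝ) i)
      ((0 : Fin N → ℝ) i + 1)} = Set.univ.pi fun _ => Set.Ioc (0 : ℝ) 1 := by
      ext x; simp
    rw [e]
    exact (Measure.univ_pi_Ioc_ae_eq_Icc (μ := fun _ : Fin N => (volume : Measure ℝ))
      (f := 0) (g := 1)).trans (cube_ae_eq_Icc N).symm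
  exact h2.comp h1

/-- The isometric embedding of `L²` of the cube in `L²` of the torus. -/
def L2toTorus (N : ℕ) : L2 N →ₗᵢ[ℂ] Lp ℂ 2 (torusMeasure N) :=
  Lp.compMeasurePreservingₗᵢ ℂ torusToCube (measurePreserving_torusToCube N)

theorem coe_torusToCube {N : ℕ} (y : UnitAddTorus (Fin N)) :
    (fun i => ((torusToCube y i : ℝ) : UnitAddCircle)) = y :=
  (UnitAddTorus.measurableEquivPiIoc (0 : Fin N → ℝ)).symm_apply_apply y

theorem L2toTorus_character {N : ℕ} (k : Fin N → ℤ) :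
    L2toTorus N (contL2 (contDiff_character k).continuous) = UnitAddTorus.mFourierLp 2 k := by
  refine (Lp.toLp_compMeasurePreserving _ (measurePreserving_torusToCube N)).trans ?_
  refine Lp.ext ?_
  filter_upwards [MemLp.coeFn_toLp ((memLp_of_continuous
    (contDiff_character k).continuous).comp_measurePreserving (measurePreserving_torusToCube N)),
    UnitAddTorus.coeFn_mFourierLp 2 k] with y h1 h2
  rw [h1, h2, Function.comp, character_eq_mFourier, coe_torusToCube]

/-- Parseval's identity on the cube. -/
theorem hasSum_norm_sq_inner_character {N : ℕ} (f : L2 N) :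
    HasSum (fun k : Fin N → ℤ => ‖inner ℂ (contL2 (contDiff_character k).continuous) f‖ ^ 2)
      (‖f‖ ^ 2) := by
  have h := UnitAddTorus.mFourierBasis.hasSum_inner_mul_inner (L2toTorus N f) (L2toTorus N f)
  have h' := Complex.hasSum_re h
  rw [LinearIsometry.inner_map_map] at h'
  have e2 : Complex.re (inner ℂ f f) = ‖f‖ ^ 2 := inner_self_eq_norm_sq (𝕜 := ℂ) f
  rw [e2] at h'
  refine h'.congr_fun fun k => ?_
  rw [UnitAddTorus.coe_mFourierBasis, ← L2toTorus_character, LinearIsometry.inner_map_map,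
    LinearIsometry.inner_map_map, ← inner_conj_symm f, Complex.conj_mul']
  norm_cast

/-- Poincaré's inequality on the torus. -/
theorem norm_fst_le_norm_snd {N : ℕ} {u : Pairs N} (hu : u ∈ H1per N)
    (h0 : ∫ x in cube N, u.fst x = 0) : ‖u.fst‖ ≤ ‖u.snd‖ := by
  refine le_of_sq_le_sq ?_ (norm_nonneg _)
  rw [PiLp.norm_sq_eq_of_L2]
  refine hasSum_le (fun k => ?_) (hasSum_norm_sq_inner_character u.fst)
    (hasSum_sum fun i _ => hasSum_norm_sq_inner_character (u.snd i))
  -- The coefficient at `k = 0` is the mean, which vanishes. For `k ≠ 0`, choose `i` with `k i ≠ 0`: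
  -- testing with the character multiplies the coefficient of `u` by a number of modulus `2π |k i| ≥
  -- 1` to give that of `∂ᵢu`.
  by_cases hk : k = 0
  · subst hk
    have : inner ℂ (contL2 (contDiff_character (0 : Fin N → ℤ)).continuous) u.fst = 0 := by
      rw [inner_contL2_left]
      simpa [character] using h0
    rw [this, norm_zero, zero_pow two_ne_zero]
    positivity
  · obtain ⟨i, hi⟩ := Function.ne_iff.1 hk
    have h1 := hu (character k) (contDiff_character k) (isSmoothPeriodic_character k) i
    have h2 : (smoothPair (character k) (contDiff_character k)).snd i =
        (2 * Real.pi * Complex.I * k i : ℂ) • contL2 (contDiff_character k).continuous := by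
      refine Eq.trans ?_ (MemLp.toLp_const_smul _ (memLp_of_continuous
        (contDiff_character k).continuous))
      exact MemLp.toLp_congr (memLp_of_continuous
        (contDiff_partialDeriv (contDiff_character k) i).continuous) _
        (Eventually.of_forall fun x => partialDeriv_character k i x)
    rw [h2, inner_smul_left] at h1
    have h3 : ‖inner ℂ (contL2 (contDiff_character k).continuous) u.fst‖ ≤
        ‖inner ℂ (contL2 (contDiff_character k).continuous) (u.snd i)‖ := by
      have h4 := congrArg norm h1
      rw [norm_mul, norm_neg] at h4
      refine le_trans ?_ h4.le
      refine le_mul_of_one_le_left (norm_nonneg _) ?_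
      have h5 : (1 : ℝ) ≤ |(k i : ℝ)| := by
        exact_mod_cast Int.one_le_abs hi
      have h6 : (1 : ℝ) ≤ 2 * Real.pi := by linarith [Real.pi_gt_three]
      simp only [RCLike.norm_conj, norm_mul, Complex.norm_I, mul_one, Complex.norm_intCast,
        Complex.norm_real, Real.norm_eq_abs, abs_of_pos Real.pi_pos, Complex.norm_ofNat]
      nlinarith
    calc _ ≤ ‖inner ℂ (contL2 (contDiff_character k).continuous) (u.snd i)‖ ^ 2 := by gcongr
      _ ≤ _ := Finset.single_le_sum (f := fun j =>
        ‖inner ℂ (contL2 (contDiff_character k).continuous) (u.snd j)‖ ^ 2)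
        (fun j _ => by positivity) (Finset.mem_univ i)

/-! ### Test functions and the Laplacian -/

theorem tsupport_partialDeriv_subset {N : ℕ} (φ : (Fin N → ℝ) → ℂ) (i : Fin N) :
    tsupport (partialDeriv i φ) ⊆ tsupport φ := by
  refine (closure_mono fun x hx => ?_).trans (tsupport_fderiv_subset ℝ)
  exact fun h => hx (by simp [partialDeriv, h])

theorem IsTestFunction.partialDeriv {N : ℕ} {φ : (Fin N → ℝ) → ℂ} (hφ : IsTestFunction φ)
    (i : Fin N) : IsTestFunction (partialDeriv i φ) :=
  ⟨contDiff_partialDeriv hφ.1 i,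
    hφ.2.1.of_isClosed_subset (isClosed_tsupport _) (tsupport_partialDeriv_subset φ i),
    (tsupport_partialDeriv_subset φ i).trans hφ.2.2⟩

theorem IsTestFunction.eq_zero {N : ℕ} {φ : (Fin N → ℝ) → ℂ} (hφ : IsTestFunction φ)
    {x : Fin N → ℝ} (hx : x ∉ cube N) : φ x = 0 :=
  image_eq_zero_of_notMem_tsupport fun h => hx (hφ.2.2 h)

/-- Smooth functions on `ℝ^N` restrict to elements of `H¹` of the cube. -/
theorem smoothPair_mem_H1 {N : ℕ} {ψ : (Fin N → ℝ) → ℂ} (hψ : ContDiff ℝ ∞ ψ) :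
    smoothPair ψ hψ ∈ H1 N := by
  intro φ hφ hT i
  have hcφ : Continuous (fun x => star (φ x)) := continuous_star.comp hφ.continuous
  have hcφ' : Continuous (fun x => star (partialDeriv i φ x)) :=
    continuous_star.comp (contDiff_partialDeriv hφ i).continuous
  have hs : HasCompactSupport (fun x => star (φ x)) := hT.2.1.comp_left (star_zero ℂ)
  have hs' : HasCompactSupport (fun x => star (partialDeriv i φ x)) :=
    (hT.partialDeriv i).2.1.comp_left (star_zero ℂ)
  have hd : ∀ x, fderiv ℝ (fun y => star (φ y)) x (Pi.single i 1) = star (partialDeriv i φ x) := by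
    intro x
    rw [fderiv_star]
    rfl
  have key := integral_mul_fderiv_eq_neg_fderiv_mul_of_integrable (μ := volume)
    (f := fun x => star (φ x)) (g := ψ) (v := (Pi.single i 1 : Fin N → ℝ))
    (by
      simp only [hd]
      exact (hcφ'.mul hψ.continuous).integrable_of_hasCompactSupport hs'.mul_right)
    ((hcφ.mul (contDiff_partialDeriv hψ i).continuous).integrable_of_hasCompactSupport
      hs.mul_right)
    ((hcφ.mul hψ.continuous).integrable_of_hasCompactSupport hs.mul_right)
    (fun x _ => ((hφ.differentiable (by simp)) x).star)
    (fun x _ => (hψ.differentiable (by simp)) x)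
  simp only [hd] at key
  have e1 : inner ℂ ((smoothPair φ hφ).snd i) (smoothPair ψ hψ).fst =
      ∫ x, star (partialDeriv i φ x) * ψ x := by
    refine (inner_toLp (contDiff_partialDeriv hφ i).continuous hψ.continuous).trans ?_
    exact setIntegral_eq_integral_of_forall_compl_eq_zero fun x hx => by
      rw [(hT.partialDeriv i).eq_zero hx, star_zero, zero_mul]
  have e2 : inner ℂ (smoothPair φ hφ).fst ((smoothPair ψ hψ).snd i) =
      ∫ x, star (φ x) * partialDeriv i ψ x := by
    refine (inner_toLp hφ.continuous (contDiff_partialDeriv hψ i).continuous).trans ?_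
    exact setIntegral_eq_integral_of_forall_compl_eq_zero fun x hx => by
      rw [hT.eq_zero hx, star_zero, zero_mul]
  rw [e1, e2]
  exact (neg_eq_iff_eq_neg.2 key).symm

theorem continuous_classicalLaplacian {N : ℕ} {φ : (Fin N → ℝ) → ℂ} (hφ : ContDiff ℝ ∞ φ) :
    Continuous (classicalLaplacian φ) :=
  continuous_finsetSum _ fun i _ =>
    (contDiff_partialDeriv (contDiff_partialDeriv hφ i) i).continuous

/-- The Laplacian of a smooth function as an element of `L²`. -/
def laplacianL2 {N : ℕ} {φ : (Fin N → ℝ) → ℂ} (hφ : ContDiff ℝ ∞ φ) : L2 N :=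
  contL2 (continuous_classicalLaplacian hφ)

/-- Each `∂ᵢφ` is itself a test function; use it in the weak gradient relation of `u` and sum over
`i`. -/
theorem inner_laplacianL2 {N : ℕ} {φ : (Fin N → ℝ) → ℂ} (hφ : IsTestFunction φ) {u : Pairs N}
    (hu : u ∈ H1 N) :
    inner ℂ (laplacianL2 hφ.1) u.fst = -inner ℂ (smoothPair φ hφ.1).snd u.snd := by
  have h1 : laplacianL2 hφ.1 =
      ∑ i, (smoothPair (partialDeriv i φ) (hφ.partialDeriv i).1).snd i := by
    refine Lp.ext ?_
    have h2 : ∀ i, ((smoothPair (partialDeriv i φ) (hφ.partialDeriv i).1).snd i : L2 N)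
        =ᵐ[cubeMeasure N] partialDeriv i (partialDeriv i φ) := fun i =>
      MemLp.coeFn_toLp (memLp_of_continuous
        (contDiff_partialDeriv (hφ.partialDeriv i).1 i).continuous)
    have h3 := Lp.coeFn_fun_finsetSum Finset.univ
      (fun i => (smoothPair (partialDeriv i φ) (hφ.partialDeriv i).1).snd i)
    filter_upwards [h3, MemLp.coeFn_toLp (memLp_of_continuous
      (continuous_classicalLaplacian hφ.1)), ae_all_iff.2 h2] with x hx3 hx4 hx2
    rw [hx3, laplacianL2, hx4, classicalLaplacian]
    exact Finset.sum_congr rfl fun i _ => (hx2 i).symm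
  rw [h1, sum_inner, PiLp.inner_apply, ← Finset.sum_neg_distrib]
  exact Finset.sum_congr rfl fun i _ => hu _ _ (hφ.partialDeriv i) i

/-- These are the elements of `V` that are tested with, both for the density of the range of `invA`
and for the heat equation. -/
theorem laplacianL2_mem_V {N : ℕ} {φ : (Fin N → ℝ) → ℂ} (hφ : IsTestFunction φ) :
    laplacianL2 hφ.1 ∈ V N := by
  intro h hh
  rw [← inner_conj_symm, inner_laplacianL2 hφ hh.1, hh.2 _ (smoothPair_mem_H10 hφ), neg_zero,
    map_zero]

theorem inner_snd_eq_zero_of_forall_testFunction {N : ℕ} {u : Pairs N}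
    (hu : ∀ (φ : (Fin N → ℝ) → ℂ) (hφ : IsTestFunction φ),
      inner ℂ (smoothPair φ hφ.1).snd u.snd = 0) {v : Pairs N} (hv : v ∈ H10 N) :
    inner ℂ v.snd u.snd = 0 := by
  let K := ((innerSL ℂ u.snd).comp
    (WithLp.sndL 2 ℂ (L2 N) (PiLp 2 fun _ : Fin N => L2 N))).ker
  have hK : H10 N ≤ K := by
    refine Submodule.topologicalClosure_minimal _ (Submodule.span_le.2 ?_)
      (ContinuousLinearMap.isClosed_ker _)
    rintro _ ⟨φ, hφ, rfl⟩
    change inner ℂ u.snd (smoothPair φ hφ.1).snd = 0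
    rw [← inner_conj_symm, hu φ hφ, map_zero]
  have : inner ℂ u.snd v.snd = 0 := hK hv
  rw [← inner_conj_symm, this, map_zero]

theorem one_mem_Har (N : ℕ) : onePair N ∈ Har N :=
  ⟨smoothPair_mem_H1 _, fun v _ => by rw [onePair_snd, inner_zero_right]⟩

theorem contDiff_coord {N : ℕ} (i : Fin N) : ContDiff ℝ ∞ fun x : Fin N → ℝ => (x i : ℂ) :=
  Complex.ofRealCLM.contDiff.comp (contDiff_apply ℝ ℝ i)

theorem partialDeriv_coord {N : ℕ} (i j : Fin N) (x : Fin N → ℝ) :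
    partialDeriv j (fun x : Fin N → ℝ => (x i : ℂ)) x = if j = i then 1 else 0 := by
  have h : HasFDerivAt (fun x : Fin N → ℝ => (x i : ℂ))
      (Complex.ofRealCLM.comp (ContinuousLinearMap.proj (R := ℝ) (φ := fun _ => ℝ) i)) x :=
    (Complex.ofRealCLM.comp (ContinuousLinearMap.proj (R := ℝ) (φ := fun _ => ℝ) i)).hasFDerivAt
  rw [partialDeriv, h.fderiv]
  by_cases hj : j = i
  · subst hj; simp
  · simp [hj]

/-- The gradient is a constant unit vector, so only `∫ ∂ᵢφ = 0` is needed for test functions `φ`;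
this is their weak gradient relation against the constant one. -/
theorem coord_mem_Har {N : ℕ} (i : Fin N) : smoothPair _ (contDiff_coord i) ∈ Har N := by
  refine ⟨smoothPair_mem_H1 _, fun v hv => inner_snd_eq_zero_of_forall_testFunction
    (fun φ hφ => ?_) hv⟩
  rw [← neg_eq_zero, ← inner_laplacianL2 hφ (smoothPair_mem_H1 _),
    inner_laplacianL2 hφ (smoothPair_mem_H1 _), neg_eq_zero, PiLp.inner_apply]
  refine Finset.sum_eq_zero fun j _ => ?_
  have h1 := (smoothPair_mem_H1per hφ) (fun _ => 1) contDiff_const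
    ⟨contDiff_const, fun _ _ => rfl⟩ j
  have h2 : (smoothPair (fun _ : Fin N → ℝ => (1 : ℂ)) contDiff_const).snd j = 0 :=
    congrArg (fun p : PiLp 2 (fun _ : Fin N => L2 N) => p j) (onePair_snd N)
  have h3 : (smoothPair _ (contDiff_coord i)).snd j = (if j = i then 1 else 0 : ℂ) • oneL2 N := by
    refine Eq.trans ?_ (MemLp.toLp_const_smul _ (memLp_of_continuous continuous_const))
    refine MemLp.toLp_congr (memLp_of_continuous
      (contDiff_partialDeriv (contDiff_coord i) j).continuous) _ (Eventually.of_forall fun x => ?_)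
    rw [partialDeriv_coord]
    simp
  rw [h2, inner_zero_left, eq_comm, neg_eq_zero] at h1
  rw [h3, inner_smul_right, ← inner_conj_symm]
  have h4 : inner ℂ (oneL2 N) ((smoothPair φ hφ.1).snd j) = 0 := h1
  rw [h4, map_zero, mul_zero]

/-! ### The Hilbert space model of `H` -/

instance (N : ℕ) : CompleteSpace (TorusH1 N) :=
  (isClosed_weakGradientSpace IsSmoothPeriodic).completeSpace_coe

theorem TorusH1.pair_mem {N : ℕ} (u : TorusH1 N) : u.pair ∈ H1per N := u.2

/-- The space of square integrable vector fields on the cube. -/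
abbrev Fields (N : ℕ) := PiLp 2 fun _ : Fin N => L2 N

/-- The inclusion of `H¹(T^N)` in `L²`. -/
def torusFst (N : ℕ) : TorusH1 N →L[ℂ] L2 N :=
  (WithLp.fstL 2 ℂ (L2 N) (Fields N)).comp TorusH1.pair

/-- The gradient on `H¹(T^N)`. -/
def torusGrad (N : ℕ) : TorusH1 N →L[ℂ] Fields N :=
  (WithLp.sndL 2 ℂ (L2 N) (Fields N)).comp TorusH1.pair

theorem torusGrad_apply {N : ℕ} (v : TorusH1 N) : torusGrad N v = v.pair.snd := rfl

/-- The functions in `H¹(T^N)` with mean zero. -/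
def meanZero (N : ℕ) : Submodule ℂ (TorusH1 N) :=
  ((innerSL ℂ (oneL2 N)).comp (torusFst N)).ker

theorem mem_meanZero {N : ℕ} {v : TorusH1 N} :
    v ∈ meanZero N ↔ ∫ x in cube N, v.pair.fst x = 0 := by
  rw [← inner_oneL2]; rfl

instance (N : ℕ) : CompleteSpace (meanZero N) :=
  (ContinuousLinearMap.isClosed_ker _).completeSpace_coe

theorem exists_meanZero_grad_eq {N : ℕ} (v : TorusH1 N) :
    ∃ w : TorusH1 N, w ∈ meanZero N ∧ torusGrad N w = torusGrad N v := by
  let o : TorusH1 N := ⟨onePair N, onePair_mem_H1per N⟩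
  have ho : torusGrad N o = 0 := onePair_snd N
  have ho' : torusFst N o = oneL2 N := onePair_fst N
  refine ⟨v - (inner ℂ (oneL2 N) (torusFst N v)) • o, ?_, ?_⟩
  · change inner ℂ (oneL2 N) (torusFst N _) = 0
    rw [map_sub, map_smul, ho', inner_sub_right, inner_smul_right, inner_oneL2_self, mul_one,
      sub_self]
  · rw [map_sub, map_smul, ho, smul_zero, sub_zero]

/-- The gradient on the functions with mean zero. -/
def meanZeroGrad (N : ℕ) : meanZero N →L[ℂ] Fields N := (torusGrad N).comp (meanZero N).subtypeL

/-- Poincaré's inequality gives `‖v‖² ≤ 2 ‖∇v‖²`; the constant `2` is a convenient bound for `√2`.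
The closed range of the gradient follows. -/
theorem antilipschitz_meanZeroGrad (N : ℕ) : AntilipschitzWith 2 (meanZeroGrad N) := by
  refine AddMonoidHomClass.antilipschitz_of_bound _ fun v => ?_
  have h1 : ‖(torusFst N v)‖ ≤ ‖torusGrad N v‖ :=
    norm_fst_le_norm_snd (v : TorusH1 N).2 (mem_meanZero.1 v.2)
  have h2 : ‖(v : TorusH1 N).pair‖ ^ 2 = ‖torusFst N v‖ ^ 2 + ‖torusGrad N v‖ ^ 2 :=
    WithLp.prod_norm_sq_eq_of_L2 _
  have h3 : ‖v‖ = ‖(v : TorusH1 N).pair‖ := rfl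
  have h4 : meanZeroGrad N v = torusGrad N v := rfl
  rw [h3, h4]
  refine le_of_sq_le_sq ?_ (by positivity)
  rw [h2, mul_pow]
  push_cast
  nlinarith [norm_nonneg (torusFst N v), norm_nonneg (torusGrad N v)]

theorem isClosed_range_meanZeroGrad (N : ℕ) : IsClosed (Set.range (meanZeroGrad N)) :=
  (antilipschitz_meanZeroGrad N).isClosed_range (meanZeroGrad N).uniformContinuous

theorem range_torusGrad (N : ℕ) :
    ((torusGrad N).range : Set (Fields N)) = Set.range (meanZeroGrad N) := by
  ext p
  constructor
  · rintro ⟨v, rfl⟩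
    obtain ⟨w, hw, h⟩ := exists_meanZero_grad_eq v
    exact ⟨⟨w, hw⟩, h⟩
  · rintro ⟨v, rfl⟩
    exact ⟨v, rfl⟩

/-- A function with zero gradient lies in `Har(T^N)`, which `g` annihilates. -/
theorem map_eq_of_grad_eq {N : ℕ} (g : H N) {v w : TorusH1 N}
    (h : torusGrad N v = torusGrad N w) : g.toDual v = g.toDual w := by
  rw [← sub_eq_zero, ← map_sub]
  refine g.2 (v - w) ⟨(v - w).2, fun z _ => ?_⟩
  have : torusGrad N (v - w) = 0 := by rw [map_sub, h, sub_self]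
  rw [← torusGrad_apply, this, inner_zero_right]

/-- Every element of `H` has a potential. -/
theorem exists_isPotential {N : ℕ} (g : H N) : ∃ u, IsPotential g u := by
  have hcl := isClosed_range_meanZeroGrad N
  let e := (meanZeroGrad N).equivRange (antilipschitz_meanZeroGrad N).injective hcl
  have : CompleteSpace (meanZeroGrad N).range := hcl.completeSpace_coe
  -- Riesz's theorem is applied on the closed range of the gradient. The conjugation turns the
  -- antilinear `g` into a linear functional; the representing field `p` is minus the gradient of
  -- the potential.
  let ℓ : (meanZeroGrad N).range →L[ℂ] ℂ := ((starL ℂ : ℂ ≃L⋆[ℂ] ℂ) : ℂ →L⋆[ℂ] ℂ).comp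
    (g.toDual.comp ((meanZero N).subtypeL.comp
      (e.symm : (meanZeroGrad N).range →L[ℂ] meanZero N)))
  let p := (InnerProductSpace.toDual ℂ _).symm ℓ
  have hp : ∀ v : meanZero N, inner ℂ (torusGrad N v) (p : Fields N) = g.toDual v := by
    intro v
    have h1 : inner ℂ p (e v) = ℓ (e v) := InnerProductSpace.toDual_symm_apply
    have h2 : ℓ (e v) = conj (g.toDual v) := by
      change conj (g.toDual (e.symm (e v))) = _
      rw [e.symm_apply_apply]
    have h3 : inner ℂ (p : Fields N) (torusGrad N v) = conj (g.toDual v) := h1.trans h2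
    rw [← inner_conj_symm, h3, Complex.conj_conj]
  refine ⟨((-e.symm p : meanZero N) : TorusH1 N), mem_meanZero.1 (-e.symm p).2, fun v => ?_⟩
  obtain ⟨w, hw, hwv⟩ := exists_meanZero_grad_eq v
  have h4 : torusGrad N ((-e.symm p : meanZero N) : TorusH1 N) = -(p : Fields N) := by
    have : torusGrad N ((e.symm p : meanZero N) : TorusH1 N) = (p : Fields N) :=
      congrArg Subtype.val (e.apply_symm_apply p)
    rw [Submodule.coe_neg, map_neg, this]
  rw [← torusGrad_apply, ← torusGrad_apply, h4, inner_neg_right, ← hwv, hp ⟨w, hw⟩,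
    map_eq_of_grad_eq g hwv]

/-! ### Potential fields and their identification with `H` -/

/-- The gradients of functions in `H¹(T^N)` that are orthogonal to those of functions in
`Har(T^N)`. -/
def potentialFields (N : ℕ) : Submodule ℂ (Fields N) :=
  (torusGrad N).range ⊓ (((HarPer N).comap (TorusH1.pair : TorusH1 N →L[ℂ] Pairs N).toLinearMap).map
    (torusGrad N).toLinearMap)ᗮ

theorem mem_potentialFields {N : ℕ} {p : Fields N} :
    p ∈ potentialFields N ↔ (∃ u : TorusH1 N, torusGrad N u = p) ∧
      ∀ v : TorusH1 N, v.pair ∈ HarPer N → inner ℂ (torusGrad N v) p = 0 := by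
  refine and_congr Iff.rfl ⟨fun h v hv => h _ ⟨v, hv, rfl⟩, ?_⟩
  rintro h _ ⟨v, hv, rfl⟩
  exact h v hv

theorem isClosed_potentialFields (N : ℕ) : IsClosed (potentialFields N : Set (Fields N)) := by
  rw [potentialFields, Submodule.coe_inf, range_torusGrad]
  exact (isClosed_range_meanZeroGrad N).inter (Submodule.isClosed_orthogonal _)

instance (N : ℕ) : CompleteSpace (potentialFields N) :=
  (isClosed_potentialFields N).completeSpace_coe

/-- The divergence of a square integrable field as a functional on `H¹(T^N)`. -/
def divergence (N : ℕ) : Fields N →L[ℂ] DualTorusH1 N :=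
  LinearMap.mkContinuous
    { toFun := fun p => -(innerSLFlip ℂ p).comp (torusGrad N)
      map_add' := fun p q => by ext v; simp; ring
      map_smul' := fun c p => by ext v; simp }
    1 fun p => by
      refine ContinuousLinearMap.opNorm_le_bound _ (by positivity) fun v => ?_
      have h : ‖-inner ℂ (torusGrad N v) p‖ ≤ ‖torusGrad N v‖ * ‖p‖ := by
        rw [norm_neg]; exact norm_inner_le_norm _ _
      refine h.trans ?_
      rw [one_mul, mul_comm]
      exact mul_le_mul_of_nonneg_left (WithLp.norm_snd_le _ (TorusH1.pair v)) (norm_nonneg _)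

/-- The map sending a gradient field in `potentialFields` to its divergence in `H`. -/
def fieldToH (N : ℕ) : potentialFields N →L[ℂ] H N :=
  ((divergence N).comp (potentialFields N).subtypeL).codRestrict (annHarPer N) fun p v hv => by
    change -inner ℂ (torusGrad N v) (p : Fields N) = 0
    rw [(mem_potentialFields.1 p.2).2 v hv, neg_zero]

theorem fieldToH_apply {N : ℕ} (p : potentialFields N) (v : TorusH1 N) :
    (fieldToH N p).toDual v = -inner ℂ (torusGrad N v) (p : Fields N) := rfl

theorem H.ext {N : ℕ} {g h : H N} (e : ∀ v, g.toDual v = h.toDual v) : g = h :=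
  Subtype.ext (ContinuousLinearMap.ext e)

theorem IsPotential.grad_mem {N : ℕ} {g : H N} {u : TorusH1 N} (h : IsPotential g u) :
    torusGrad N u ∈ potentialFields N :=
  mem_potentialFields.2 ⟨⟨u, rfl⟩, fun v hv => (h.2 v).trans (by rw [neg_eq_zero]; exact g.2 v hv)⟩

theorem IsPotential.fieldToH_grad {N : ℕ} {g : H N} {u : TorusH1 N} (h : IsPotential g u) :
    fieldToH N ⟨torusGrad N u, h.grad_mem⟩ = g :=
  H.ext fun v => by
    rw [fieldToH_apply]
    exact neg_eq_iff_eq_neg.2 (h.2 v)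

/-- Write `p = ∇u` and test the divergence of `p` with `u`: the result is `-‖p‖²`. -/
theorem fieldToH_injective (N : ℕ) : Function.Injective (fieldToH N) := by
  rw [injective_iff_map_eq_zero]
  intro p hp
  obtain ⟨u, hu⟩ := (mem_potentialFields.1 p.2).1
  have h := fieldToH_apply p u
  rw [hp, hu, map_zero, zero_apply, eq_comm, neg_eq_zero, inner_self_eq_zero] at h
  exact Subtype.ext h

theorem fieldToH_surjective (N : ℕ) : Function.Surjective (fieldToH N) := fun g => by
  obtain ⟨u, hu⟩ := exists_isPotential g
  exact ⟨_, hu.fieldToH_grad⟩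

/-- Needed for the open mapping theorem, which makes the bijection `fieldToH` a homeomorphism. -/
instance (N : ℕ) : CompleteSpace (H N) := by
  have : IsClosed (annHarPer N : Set (DualTorusH1 N)) := by
    have e : (annHarPer N : Set (DualTorusH1 N)) =
        ⋂ (v : TorusH1 N), ⋂ (_ : v.pair ∈ HarPer N), {w | w v = 0} := by
      ext w; simp [annHarPer]
    rw [e]
    exact isClosed_iInter fun v => isClosed_iInter fun _ =>
      isClosed_eq (ContinuousEvalConst.continuous_eval_const v) continuous_const
  exact this.completeSpace_coe

/-- The isomorphism between the Hilbert space of potential fields and `H`. -/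
def fieldEquivH (N : ℕ) : potentialFields N ≃L[ℂ] H N :=
  ContinuousLinearEquiv.ofBijective (fieldToH N)
    (LinearMap.ker_eq_bot.2 (fieldToH_injective N))
    (LinearMap.range_eq_top.2 (fieldToH_surjective N))

theorem fieldEquivH_apply {N : ℕ} (p : potentialFields N) (v : TorusH1 N) :
    (fieldEquivH N p).toDual v = -inner ℂ (torusGrad N v) (p : Fields N) := rfl

theorem IsPotential.fieldEquivH_symm {N : ℕ} {g : H N} {u : TorusH1 N} (h : IsPotential g u) :
    ((fieldEquivH N).symm g : Fields N) = u.pair.snd := by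
  have : (fieldEquivH N).symm g = ⟨torusGrad N u, h.grad_mem⟩ :=
    (fieldEquivH N).symm_apply_eq.2 h.fieldToH_grad.symm
  rw [this]
  rfl

/-! ### The operator `A` -/

instance (N : ℕ) : CompleteSpace (V N) := by
  have : IsClosed (V N : Set (L2 N)) := by
    have e : (V N : Set (L2 N)) = ⋂ (h : Pairs N), ⋂ (_ : h ∈ Har N),
        {f | inner ℂ h.fst f = 0} := by
      ext w; simp [V]
    rw [e]
    exact isClosed_iInter fun v => isClosed_iInter fun _ =>
      isClosed_eq (continuous_const.inner continuous_id) continuous_const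
  exact this.completeSpace_coe

/-- The embedding of `V` in the Hilbert space of potential fields. -/
def VtoField (N : ℕ) : V N →L[ℂ] potentialFields N :=
  ((fieldEquivH N).symm : H N →L[ℂ] potentialFields N).comp (VtoH N)

theorem fieldEquivH_VtoField {N : ℕ} (f : V N) : fieldEquivH N (VtoField N f) = VtoH N f :=
  (fieldEquivH N).apply_symm_apply _

/-- The inverse of the operator `A`, acting on potential fields. -/
def invA (N : ℕ) : potentialFields N →L[ℂ] potentialFields N :=
  (VtoField N).comp (ContinuousLinearMap.adjoint (VtoField N))

/-- The divergence of `J h` is `h`; pair it with `u`. Consequently `J* ∇u` is minus the orthogonal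
projection of `u` to `V`. -/
theorem inner_VtoField {N : ℕ} (h : V N) (p : potentialFields N) {u : TorusH1 N}
    (hu : torusGrad N u = p) : inner ℂ (VtoField N h) p = -inner ℂ (h : L2 N) u.pair.fst := by
  have h1 := fieldEquivH_apply (VtoField N h) u
  rw [fieldEquivH_VtoField, hu] at h1
  have h2 : (VtoH N h).toDual u = inner ℂ u.pair.fst (h : L2 N) := rfl
  have h3 : inner ℂ p (VtoField N h) = -inner ℂ u.pair.fst (h : L2 N) := by
    rw [← h2, h1, neg_neg]; rfl
  rw [← inner_conj_symm (VtoField N h) p, h3, map_neg, inner_conj_symm]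

theorem isPositive_invA (N : ℕ) : (invA N).IsPositive :=
  ContinuousLinearMap.isPositive_self_comp_adjoint _

theorem denseRange_invA (N : ℕ) : DenseRange (invA N) := by
  have h : (invA N).range.topologicalClosure = ⊤ := by
    rw [Submodule.topologicalClosure_eq_top_iff, Submodule.eq_bot_iff]
    intro p hp
    -- `⟨J J* p, p⟩ = ‖J* p‖²`.
    have h0 : ContinuousLinearMap.adjoint (VtoField N) p = 0 := by
      have h1 : inner ℂ (invA N p) p = 0 := hp _ ⟨p, rfl⟩
      have h2 : inner ℂ (VtoField N (ContinuousLinearMap.adjoint (VtoField N) p)) p = 0 := h1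
      rwa [← ContinuousLinearMap.adjoint_inner_right, inner_self_eq_zero] at h2
    obtain ⟨⟨u, hu⟩, hperp⟩ := mem_potentialFields.1 p.2
    have h3 : ∀ h : V N, inner ℂ (h : L2 N) u.pair.fst = 0 := fun h => by
      have := inner_VtoField h p hu
      rw [← ContinuousLinearMap.adjoint_inner_right, h0, inner_zero_right, eq_comm,
        neg_eq_zero] at this
      exact this
    have h4 : u.pair ∈ HarPer N := by
      refine ⟨u.pair_mem, fun v hv => inner_snd_eq_zero_of_forall_testFunction (fun φ hφ => ?_) hv⟩
      rw [← neg_eq_zero, ← inner_laplacianL2 hφ (H1per_le_H1 N u.pair_mem)]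
      exact h3 ⟨_, laplacianL2_mem_V hφ⟩
    have h5 := hperp u h4
    rw [hu, inner_self_eq_zero] at h5
    exact Subtype.ext h5
  rw [DenseRange, dense_iff_closure_eq]
  exact congrArg (fun s : Submodule ℂ (potentialFields N) => (s : Set (potentialFields N))) h

/-- The right-hand side of the identity defining `A` is `⟨J h, ∇u_g⟩ = ⟨h, J* ∇u_g⟩`, and `h` runs
through all of `V`. -/
theorem isA_iff {N : ℕ} {f : V N} {g : H N} :
    IsA f g ↔ f = ContinuousLinearMap.adjoint (VtoField N) ((fieldEquivH N).symm g) := by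
  have key : ∀ (h : V N) (ug uh : TorusH1 N), IsPotential g ug → IsPotential (VtoH N h) uh →
      inner ℂ uh.pair.snd ug.pair.snd = inner ℂ h
        (ContinuousLinearMap.adjoint (VtoField N) ((fieldEquivH N).symm g)) := by
    intro h ug uh hug huh
    rw [ContinuousLinearMap.adjoint_inner_right, ← hug.fieldEquivH_symm, ← huh.fieldEquivH_symm]
    rfl
  constructor
  · rintro ⟨ug, hug, hA⟩
    refine ext_inner_left ℂ fun h => ?_
    obtain ⟨uh, huh, e⟩ := hA h
    rw [← key h ug uh hug huh, ← e]
    rfl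
  · rintro rfl
    obtain ⟨ug, hug⟩ := exists_isPotential g
    refine ⟨ug, hug, fun h => ?_⟩
    obtain ⟨uh, huh⟩ := exists_isPotential (VtoH N h)
    exact ⟨uh, huh, (key h ug uh hug huh).symm⟩

theorem graphNegA_eq (N : ℕ) : graphNegA N = (fun p : potentialFields N × potentialFields N =>
    (fieldEquivH N p.1, fieldEquivH N p.2)) '' {p | ∃ a, p = (invA N a, -a)} := by
  ext p
  constructor
  · rintro ⟨f, g, h, rfl⟩
    refine ⟨_, ⟨(fieldEquivH N).symm g, rfl⟩, ?_⟩
    rw [isA_iff] at h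
    refine Prod.ext ?_ ?_
    · rw [h]
      exact fieldEquivH_VtoField _
    · simp
  · rintro ⟨_, ⟨a, rfl⟩, rfl⟩
    refine ⟨ContinuousLinearMap.adjoint (VtoField N) a, fieldEquivH N a, ?_, ?_⟩
    · rw [isA_iff, (fieldEquivH N).symm_apply_apply]
    · refine Prod.ext (fieldEquivH_VtoField _) ?_
      simp

/-- The semigroup generated by `-A`. -/
def heatSemigroup (N : ℕ) : ℝ≥0 → H N →L[ℂ] H N := conjOp (fieldEquivH N) (expNegInvOp (invA N))

theorem isExpNegA_heatSemigroup (N : ℕ) : IsExpNegA (heatSemigroup N) := by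
  refine ⟨(isC0Semigroup_expNegInvOp (isPositive_invA N) (denseRange_invA N)).conjOp _, ?_⟩
  rw [heatSemigroup, generatorGraph_conjOp,
    generatorGraph_expNegInvOp (isPositive_invA N) (denseRange_invA N), graphNegA_eq]

theorem IsExpNegA.eq_heatSemigroup {N : ℕ} {S : ℝ≥0 → H N →L[ℂ] H N} (hS : IsExpNegA S) :
    S = heatSemigroup N := by
  have h : conjOp (fieldEquivH N).symm S = expNegInvOp (invA N) := by
    refine eq_expNegInvOp (isPositive_invA N) (denseRange_invA N) (hS.1.conjOp _) ?_
    rw [generatorGraph_conjOp, hS.2, graphNegA_eq, Set.image_image]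
    simp
  rw [heatSemigroup, ← h]
  exact (conjOp_symm_conjOp (fieldEquivH N).symm S).symm

/-- If `A f = g`, then `-g`, restricted to `H¹₀`, is the distributional Laplacian of `f`. -/
theorem isDistribLaplacian_of_isA {N : ℕ} {f : V N} {g : H N} (h : IsA f g)
    {φ : (Fin N → ℝ) → ℂ} (hφ : IsTestFunction φ) :
    -g.toDual (H10toTorus ⟨smoothPair φ hφ.1, smoothPair_mem_H10 hφ⟩) =
      ∫ x in cube N, (f : L2 N) x * conj (classicalLaplacian φ x) := by
  obtain ⟨u, hu⟩ := exists_isPotential g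
  -- Since `f = J* ∇u` and `Δφ ∈ V`, the function `f` acts on `Δφ` as `-u` does; integration by
  -- parts then leads to `⟨g, φ⟩`.
  have h1 : inner ℂ (laplacianL2 hφ.1) (f : L2 N) =
      -inner ℂ (laplacianL2 hφ.1) u.pair.fst := by
    rw [isA_iff.1 h]
    refine (ContinuousLinearMap.adjoint_inner_right (VtoField N)
      ⟨_, laplacianL2_mem_V hφ⟩ _).trans ?_
    exact inner_VtoField _ _ hu.fieldEquivH_symm.symm
  rw [inner_laplacianL2 hφ (H1per_le_H1 N u.pair_mem), neg_neg] at h1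
  have h2 := hu.2 (H10toTorus ⟨smoothPair φ hφ.1, smoothPair_mem_H10 hφ⟩)
  rw [← h2]
  refine h1.symm.trans ?_
  rw [laplacianL2, inner_contL2_left]
  simp only [mul_comm]

/-- The inclusion of `H¹₀` in `H¹(T^N)` as a continuous linear map. -/
def H10toTorusL (N : ℕ) : H10 N →L[ℂ] TorusH1 N :=
  (H10 N).subtypeL.codRestrict (H1per N) fun g => H10_le_H1per N g.2

theorem H10toTorusL_apply {N : ℕ} (g : H10 N) : H10toTorusL N g = H10toTorus g := rfl

theorem V.integral_mul_conj_eq_zero {N : ℕ} (f : V N) {h : Pairs N} (hh : h ∈ Har N) :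
    ∫ y in cube N, (f : L2 N) y * conj (h.fst y) = 0 := by
  have := f.2 h hh
  rw [L2.inner_def] at this
  simpa only [RCLike.inner_apply] using this

theorem V.integral_eq_zero {N : ℕ} (f : V N) : ∫ y in cube N, (f : L2 N) y = 0 := by
  rw [← inner_oneL2]
  exact f.2 _ (one_mem_Har N)

theorem V.integral_coord_mul_eq_zero {N : ℕ} (f : V N) (i : Fin N) :
    ∫ y in cube N, (y i : ℂ) * (f : L2 N) y = 0 := by
  have h : inner ℂ (contL2 (contDiff_coord i).continuous) (f : L2 N) = 0 :=
    f.2 _ (coord_mem_Har i)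
  rw [inner_contL2_left] at h
  simpa only [Complex.conj_ofReal] using h

end HeatCube

end

/-! ### The theorem -/

open HeatCube
theorem mainTheorem5 (N : ℕ) (hN : 1 ≤ N) :
    (∃! S : ℝ≥0 → H N →L[ℂ] H N, IsExpNegA S) ∧
    ∀ S : ℝ≥0 → H N →L[ℂ] H N, IsExpNegA S →
    ∀ u₀ : V N, u₀ ∈ domA N →
    ∃ u : ℝ≥0 → L2 N,
      (∀ t, L2toDual N (u t) = (S t (VtoH N u₀)).toDual) ∧
      u 0 = u₀ ∧
      ∀ t : ℝ≥0, 0 < t →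
        (∀ h ∈ Har N, ∫ y in cube N, u t y * conj (h.fst y) = 0) ∧
        (∃ u' : H N,
          HasDerivAt (fun s : ℝ => S s.toNNReal (VtoH N u₀)) u' (t : ℝ) ∧
          ∃ D : H10 N →L⋆[ℂ] ℂ, IsDistribLaplacian (u t) D ∧
            ∀ g : H10 N,
              u'.toDual (H10toTorus g) - D g = 0) ∧
        ∫ y in cube N, u t y = 0 ∧
        ∀ i : Fin N, ∫ y in cube N, (y i : ℂ) * u t y = 0 := by
  refine ⟨⟨heatSemigroup N, isExpNegA_heatSemigroup N, fun S hS => hS.eq_heatSemigroup⟩, ?_⟩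
  intro S hS u₀ hu₀
  obtain rfl := hS.eq_heatSemigroup
  obtain ⟨g, hg⟩ := hu₀
  have hT := isPositive_invA N
  have hd := denseRange_invA N
  set a := (fieldEquivH N).symm g
  have hu₀ : u₀ = ContinuousLinearMap.adjoint (VtoField N) a := isA_iff.1 hg
  have hVa : VtoField N u₀ = invA N a := by rw [hu₀]; rfl
  -- `u(t)` is defined through `J*`, so it lies in `V` from the outset. Its image under `J` is the
  -- orbit because `T = J J*` commutes with the semigroup.
  let w : ℝ≥0 → V N := fun t =>
    ContinuousLinearMap.adjoint (VtoField N) (expNegInvOp (invA N) t a)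
  have hw : ∀ t, IsA (w t) (fieldEquivH N (expNegInvOp (invA N) t a)) := fun t => by
    rw [isA_iff, (fieldEquivH N).symm_apply_apply]
  have hS : ∀ t, heatSemigroup N t (VtoH N u₀) =
      fieldEquivH N (expNegInvOp (invA N) t (invA N a)) := fun t => by
    rw [← hVa]; rfl
  refine ⟨fun t => w t, fun t => ?_, ?_, fun t ht => ⟨fun h hh => V.integral_mul_conj_eq_zero _ hh,
    ⟨fieldEquivH N (expNegInvOp (invA N) t (-a)), ?_, ?_⟩, V.integral_eq_zero _,
    V.integral_coord_mul_eq_zero _⟩⟩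
  · rw [hS, expNegInvOp_comm hT]
    exact congrArg H.toDual (fieldEquivH_VtoField (w t)).symm
  · simp only [w, expNegInvOp_zero hT, hu₀]
    rfl
  · simp only [hS]
    exact ((fieldEquivH N : potentialFields N →L[ℂ] H N).restrictScalars
      ℝ).hasFDerivAt.comp_hasDerivAt (t : ℝ) (hasDerivAt_expNegInvOp hT hd a ht)
  -- The extension `D` is taken to be the time derivative restricted to `H¹₀`, so the equation
  -- itself is trivial. The content is that `D`, which is `-A u(t)`, is the distributional
  -- Laplacian.
  · refine ⟨(fieldEquivH N (expNegInvOp (invA N) t (-a))).toDual.comp (H10toTorusL N),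
      fun φ hφ => ?_, fun g => ?_⟩
    · refine Eq.trans ?_ (isDistribLaplacian_of_isA (hw t) hφ)
      rw [ContinuousLinearMap.comp_apply, H10toTorusL_apply, map_neg, map_neg, map_neg]
      rfl
    · rw [ContinuousLinearMap.comp_apply, H10toTorusL_apply, sub_self]
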